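/- Let $\mathbb N=\{1,2,\dots\}$ and $\mathbb N_0=\mathbb N\cup\{0\}$. Let $p:\mathbb R\to[1,\infty)$ be a measurable, $2\pi$-periodic, essentially bounded exponent for which there is $c>0$ with $$\left|\tfrac1{p(x)}-\tfrac1{p(y)}\right|\le \frac{c}{\ln(e+1/|x-y|)}\qquad\text{for all } x,y\in[-\pi,\pi].$$ Let $\omega:\mathbb R\to[0,\infty]$ be measurable, $2\pi$-periodic and a.e. positive, and let $\omega\in A_{p(\cdot)}$, i.e. $$\sup_{B}\ \frac{\int_B\omega\,dx}{|B|^{p_B}}\ \Big\|\frac1\omega\Big\|_{B,\,p'(\cdot)/p(\cdot)}<\infty,\qquad \frac1{p_B}:=\frac1{|B|}\int_B\frac{dx}{p(x)},$$ where $B$ runs over the open intervals of $\mathbb R$ with $0<|B|\le 2\pi$, $p'=p/(p-1)$ ($p'=\infty$ where $p=1$), and $\|g\|_{B,s(\cdot)}=\inf\{a>0:\int_B|g/a|^{s(x)}dx\le1\}$ (with $t^\infty=0$ for $0\le t\le1$ and $t^\infty=\infty$ for $t>1$). For a measurable $2\pi$-periodic function $f$ put $$\|f\|_{p(\cdot),\omega}=\inf\Big\{a>0:\int_{-\pi}^{\pi}|f(x)/a|^{p(x)}\omega(x)\,dx\le1\Big\},$$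 let $L^{p(\cdot)}_{2\pi,\omega}$ be the space of real-valued such $f$ with $\|f\|_{p(\cdot),\omega}<\infty$, and let $W^s_{p(\cdot),\omega}$ be the set of $f\in L^{p(\cdot)}_{2\pi,\omega}$ such that $f^{(s-1)}$ is absolutely continuous and $f^{(s)}\in L^{p(\cdot)}_{2\pi,\omega}$ (with $W^0_{p(\cdot),\omega}=L^{p(\cdot)}_{2\pi,\omega}$). Let $E_n(f)_{p(\cdot),\omega}=\inf_T\|f-T\|_{p(\cdot),\omega}$, the infimum being over all complex trigonometric polynomials $T$ of degree at most $n$. For $n,k\in\mathbb N$ let $J_{k,n}(u)=\varkappa^{-1}\big(\sin(mu/2)/\sin(u/2)\big)^{2k}$ with $m=\lfloor n/k\rfloor+1$ be the Jackson kernel, where $\varkappa>0$ is chosen so that $\frac1\pi\int_{-\pi}^{\pi}J_{k,n}(u)\,du=1$. For $r\in\mathbb N_0$ define the Jackson–Stechkin operator $$D_{n,r,k}f(x)=\frac1\pi\int_{-\pi}^{\pi}\big[f(x)+(-1)^{r+1}\tilde\Delta_u^rf(x)\big]J_{k,n}(u)\,du,\qquad \tilde\Delta_uf(x)=f(x+u)-f(x),$$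 where $\tilde\Delta_u^r$ is the $r$-fold iterate of $\tilde\Delta_u$; write $D_{n,r}=D_{n,r,r}$ for $r\ge1$. Let $r\in\mathbb N_0$. (1) For every $k\in\mathbb N$ with $r\le 2k-2$ (in particular for $k=r$, that is, for $D_{n,r}$, whenever $r\ge2$) there is a constant $C>0$ depending only on $k,r,p,\omega$ such that for all $\alpha\in\mathbb N_0$, $n\in\mathbb N$ and $f\in W^{\alpha+r}_{p(\cdot),\omega}$ $$E_n(f^{(\alpha)})_{p(\cdot),\omega}\le\|f^{(\alpha)}-D_{n,r,k}f^{(\alpha)}\|_{p(\cdot),\omega}\le \frac{C}{n^{r}}\,\|f^{(\alpha+r)}\|_{p(\cdot),\omega}.$$ (2) There is a constant $C>0$ depending only on $r,p,\omega$ such that for all $\alpha\in\mathbb N_0$, $n\in\mathbb N$ and $f\in W^{\alpha+r}_{p(\cdot),\omega}$ $$n^r\,E_n(f^{(\alpha)})_{p(\cdot),\omega}\le C\,E_n(f^{(\alpha+r)})_{p(\cdot),\omega}.$$ -/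

import Mathlib

open Real Set MeasureTheory
open scoped ENNReal NNReal

noncomputable section

/-! ## Variable exponents -/

/-- The class of log-Hölder continuous variable exponents: `2π`-periodic measurable functions
`p` with values in `[1, ∞)`, essentially bounded, such that `1 / p` satisfies the local
log-Hölder condition on `[-π, π]`. (At `x = y` the condition is trivial.) -/
structure IsLogHolderExponent (p : ℝ → ℝ) : Prop where
  periodic : Function.Periodic p (2 * π)
  aemeasurable : AEMeasurable p volume
  one_le : ∀ x, 1 ≤ p x
  bounded : ∃ M : ℝ, ∀ᵐ x, p x ≤ M
  logHolder : ∃ c : ℝ, 0 < c ∧ ∀ x ∈ Icc (-π) π, ∀ y ∈ Icc (-π) π,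
    |1 / p x - 1 / p y| ≤ c / Real.log (Real.exp 1 + 1 / |x - y|)

/-- The conjugate exponent `p' (x) = p x / (p x - 1)`, which is `∞` where `p x = 1`. -/
def dualExponent (p : ℝ → ℝ) (x : ℝ) : ℝ≥0∞ :=
  if p x = 1 then ∞ else ENNReal.ofReal (p x / (p x - 1))

/-! ## Luxemburg norms -/

/-- `t ^ s` for `s ∈ [0, ∞]`, where `t ^ ∞` is `0` for `t ≤ 1` and `∞` for `t > 1`, the usual
convention that makes the Luxemburg norm with exponent `∞` the essential supremum norm. -/
def expPow (s t : ℝ≥0∞) : ℝ≥0∞ :=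
  if s = ∞ then (if t ≤ 1 then 0 else ∞) else t ^ s.toReal

/-- The modular `∫_B g(x)^{s(x)} w(x) dx`. -/
def modular (B : Set ℝ) (s w g : ℝ → ℝ≥0∞) : ℝ≥0∞ :=
  ∫⁻ x in B, expPow (s x) (g x) * w x

/-- The Luxemburg functional `inf {a > 0 : ∫_B (g(x)/a)^{s(x)} w(x) dx ≤ 1}`, with value `∞` if
there is no such `a`. -/
def luxemburg (B : Set ℝ) (s w g : ℝ → ℝ≥0∞) : ℝ≥0∞ :=
  ⨅ (a : ℝ≥0) (_ : 0 < a) (_ : modular B s w (fun x => g x / a) ≤ 1), (a : ℝ≥0∞)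

/-- The norm `‖f‖_{p(·),ω}` over one period `[-π, π]`, for real or complex valued `f`. -/
def wNorm {E : Type*} [NormedAddCommGroup E] (p : ℝ → ℝ) (ω : ℝ → ℝ≥0∞) (f : ℝ → E) : ℝ≥0∞ :=
  luxemburg (Icc (-π) π) (fun x => ENNReal.ofReal (p x)) ω (fun x => ‖f x‖ₑ)

/-- The weighted variable exponent Lebesgue space of `2π`-periodic real functions. -/
structure MemWL (p : ℝ → ℝ) (ω : ℝ → ℝ≥0∞) (f : ℝ → ℝ) : Prop where
  periodic : Function.Periodic f (2 * π)
  aemeasurable : AEMeasurable f volume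
  norm_lt_top : wNorm p ω f < ∞

/-! ## Weights -/

/-- A `2π`-periodic weight: Lebesgue measurable and almost everywhere positive. -/
structure IsPeriodicWeight (ω : ℝ → ℝ≥0∞) : Prop where
  periodic : Function.Periodic ω (2 * π)
  aemeasurable : AEMeasurable ω volume
  pos : ∀ᵐ x, 0 < ω x

/-- The harmonic mean `p_B` of `p` over `B = (a, b)`: `1 / p_B = |B|⁻¹ ∫_B dx / p(x)`. -/
def harmonicMean (p : ℝ → ℝ) (a b : ℝ) : ℝ :=
  ((b - a)⁻¹ * ∫ x in a..b, 1 / p x)⁻¹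

/-- The variable Muckenhoupt constant
`sup_B ‖ω‖_{L¹(B)} |B|^{-p_B} ‖1/ω‖_{B, p'(·)/p(·)}`. For periodic data the balls `B` of the
circle are the intervals `(a, b)` of the line of length at most `2π`. -/
def muckenhouptConst (p : ℝ → ℝ) (ω : ℝ → ℝ≥0∞) : ℝ≥0∞ :=
  ⨆ (a : ℝ) (b : ℝ) (_ : a < b) (_ : b - a ≤ 2 * π),
    (∫⁻ x in Ioo a b, ω x) / ENNReal.ofReal ((b - a) ^ harmonicMean p a b) *
      luxemburg (Ioo a b) (fun x => dualExponent p x / ENNReal.ofReal (p x)) (fun _ => 1)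
        (fun x => (ω x)⁻¹)

/-- The variable Muckenhoupt class `A_{p(·)}` of `2π`-periodic weights. -/
structure IsMuckenhoupt (p : ℝ → ℝ) (ω : ℝ → ℝ≥0∞) : Prop where
  weight : IsPeriodicWeight ω
  const_lt_top : muckenhouptConst p ω < ∞

/-! ## Sobolev classes -/

/-- The class `W^s_{p(·),ω}`: `f` lies in the space and, if `s ≥ 1`, the derivative of order
`s - 1` exists everywhere and is absolutely continuous, and the derivative of order `s` (which
then exists almost everywhere) lies in the space. -/
structure MemSobolev (p : ℝ → ℝ) (ω : ℝ → ℝ≥0∞) (s : ℕ) (f : ℝ → ℝ) : Prop where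
  mem : MemWL p ω f
  contDiff : 1 ≤ s → ContDiff ℝ ((s - 1 : ℕ) : ℕ∞) f
  absCont : 1 ≤ s → AbsolutelyContinuousOnInterval (iteratedDeriv (s - 1) f) (-π) π
  mem_deriv : MemWL p ω (iteratedDeriv s f)

/-! ## Trigonometric approximation -/

/-- Complex trigonometric polynomials of degree at most `n`. -/
def trigPoly (n : ℕ) : Set (ℝ → ℂ) :=
  {T | ∃ c : ℤ → ℂ, ∀ x : ℝ,
    T x = ∑ j ∈ Finset.Icc (-(n : ℤ)) (n : ℤ), c j * Complex.exp ((j : ℂ) * x * Complex.I)}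

/-- The best approximation error `E_n(f)_{p(·),ω}`. -/
def bestApprox (p : ℝ → ℝ) (ω : ℝ → ℝ≥0∞) (n : ℕ) (f : ℝ → ℝ) : ℝ≥0∞ :=
  ⨅ T ∈ trigPoly n, wNorm p ω (fun x => (f x : ℂ) - T x)

/-- The unnormalized Jackson kernel `(sin (mx/2) / sin (x/2))^{2k}`, `m = ⌊n/k⌋ + 1`. -/
def jacksonCore (k n : ℕ) (x : ℝ) : ℝ :=
  (Real.sin (((n / k + 1 : ℕ) : ℝ) * x / 2) / Real.sin (x / 2)) ^ (2 * k)

/-- The Jackson kernel `J_{k,n}`, normalized by `π⁻¹ ∫ J_{k,n} = 1`. -/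
def jacksonKernel (k n : ℕ) (x : ℝ) : ℝ :=
  jacksonCore k n x / (1 / π * ∫ t in (-π)..π, jacksonCore k n t)

/-- The Jackson–Stechkin operator of order `r` with Jackson kernel `J_{k,n}`:
`x ↦ π⁻¹ ∫ [f(x) + (-1)^{r+1} Δ_u^r f(x)] J_{k,n}(u) du`, where `Δ_u f (x) = f (x + u) - f x`.
The choice `k = r` is the operator `D_{n,r}`. -/
def jacksonStechkin (k r n : ℕ) (f : ℝ → ℝ) (x : ℝ) : ℝ :=
  1 / π * ∫ u in (-π)..π, (f x + (-1) ^ (r + 1) * ((fwdDiff u)^[r] f) x) * jacksonKernel k n u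

end

noncomputable section

/-! ## Log-Hölder exponents -/

/-! The engine is that the averages of $f$ over $(x-h,x+h)$, $0<h\le\pi$, are bounded on the
weighted space uniformly in $h$ (`exists_periodModular_ballAverage_le`). No maximal function is
needed. On one interval $B$ where the average of $f$ is at least 1, a Young-type inequality with the
weight and its dual replaces Hölder. Log-Hölder continuity lets every $p(y)$, $y\in B$, be exchanged
for $p_B$ at bounded cost, and the Muckenhoupt constant absorbs the rest. Tonelli then sums over
$x$, and places where the average is below 1 cost only the mass of $\omega$. If that mass is
infinite, the unit modular ball contains only null functions.

For the direct estimate, $F-D_{n,r,k}F=\frac1\pi\int(-1)^r\tilde\Delta_u^rF\,J_{k,n}(u)\,du$.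
Trading $r-1$ differences for derivatives and the last one for an integral of $G=F^{(r)}$ bounds
$|\tilde\Delta_u^rF(x)|$ by a constant times $|u|^r$ times an average of $|G|$ near $x$. So the
error is dominated by a superposition of averages with density $|u|^rJ_{k,n}(u)$, whose mass is
$O(n^{-r})$ when $r+2\le 2k$. Jensen's inequality keeps unit modular balls stable under
superposition. As $D_{n,r,k}F$ is a trigonometric polynomial of degree at most $n$, this proves (1).

For (2), let $T$ be any polynomial of degree at most $n$. Since $G$ has mean zero, replacing $T$ by
its real part without the mean costs only a constant, again by boundedness of averages. The result
has a trigonometric primitive $S$ of order $r$, and the direct estimate for $F-S$ shows that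
$S+D_{n,r,k}(F-S)$ is a good enough competitor. -/

theorem one_le_log_exp_add {t : ℝ} (ht : 0 ≤ t) : 1 ≤ Real.log (Real.exp 1 + t) := by
  rw [Real.le_log_iff_exp_le (by positivity)]
  linarith

theorem div_log_mono {c s t : ℝ} (hc : 0 ≤ c) (hs : 0 < s) (hst : s ≤ t) :
    c / Real.log (Real.exp 1 + 1 / s) ≤ c / Real.log (Real.exp 1 + 1 / t) := by
  have ht : 0 < t := hs.trans_le hst
  have h1 := one_le_log_exp_add (t := 1 / t) (by positivity)
  apply div_le_div_of_nonneg_left hc (by linarith)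
  apply Real.log_le_log (by positivity)
  gcongr

/-- An almost everywhere bound holds on a dense set, and the log-Hölder condition carries it to
every point, at the price of a factor 2. Later estimates use the exponent at individual points. -/
theorem IsLogHolderExponent.exists_le {p : ℝ → ℝ} (hp : IsLogHolderExponent p) :
    ∃ M : ℝ, 1 ≤ M ∧ ∀ x, p x ≤ M := by
  obtain ⟨M₀, hM₀⟩ := hp.bounded
  obtain ⟨c, hc, hlog⟩ := hp.logHolder
  set M := max M₀ 1
  have hM1 : 1 ≤ M := le_max_right _ _
  have hM : ∀ᵐ x, p x ≤ M := hM₀.mono fun x hx => hx.trans (le_max_left _ _)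
  have hdense := Measure.dense_of_ae hM
  have key : ∀ x ∈ Icc (-π) π, p x ≤ 2 * M := by
    intro x hx
    -- Within distance $e^{-2Mc}$ the modulus of continuity of $1/p$ is at most $1/(2M)$, half of
    -- the lower bound $1/M$ for $1/p(y)$.
    set δ := Real.exp (-(2 * M * c)) with hδ
    have hδ0 : 0 < δ := Real.exp_pos _
    have hne : (Ioo (max (-π) (x - δ)) (min π (x + δ))).Nonempty := by
      rw [nonempty_Ioo]
      have := Real.pi_pos
      simp only [max_lt_iff, lt_min_iff]
      exact ⟨⟨by linarith, by linarith [hx.2]⟩, by linarith [hx.1], by linarith⟩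
    obtain ⟨y, hy, hyM⟩ := hdense.inter_open_nonempty _ isOpen_Ioo hne
    simp only [mem_Ioo, max_lt_iff, lt_min_iff] at hy
    simp only [mem_ofPred_eq] at hyM
    have hxy := hlog x hx y ⟨hy.1.1.le, hy.2.1.le⟩
    have hpx := hp.one_le x
    have hpy := hp.one_le y
    by_cases hne : x = y
    · rw [hne]; linarith
    have hpos : 0 < |x - y| := abs_pos.mpr (sub_ne_zero.mpr hne)
    have hle : |x - y| ≤ δ := by
      rw [abs_le]; exact ⟨by linarith [hy.2.2], by linarith [hy.1.2]⟩
    have h2 := hxy.trans (div_log_mono hc.le hpos hle)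
    have h3 : 2 * M * c ≤ Real.log (Real.exp 1 + 1 / δ) := by
      rw [Real.le_log_iff_exp_le (by positivity), hδ, Real.exp_neg, one_div, inv_inv]
      linarith [Real.exp_pos 1]
    have h4 : c / Real.log (Real.exp 1 + 1 / δ) ≤ 1 / (2 * M) := by
      rw [div_le_div_iff₀ (by nlinarith) (by positivity)]
      linarith
    have h5 : 1 / M ≤ 1 / p y := one_div_le_one_div_of_le (by linarith) hyM
    have h6 := (abs_le.mp (h2.trans h4)).1
    have h7 : 1 / (2 * M) ≤ 1 / p x := by
      have : 1 / M = 1 / (2 * M) + 1 / (2 * M) := by field_simp; norm_num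
      linarith
    exact (one_div_le_one_div (by positivity) (by linarith)).mp h7
  refine ⟨2 * M, by linarith, fun x => ?_⟩
  obtain ⟨y, hy, hxy⟩ := hp.periodic.exists_mem_Ico Real.two_pi_pos x (-π)
  rw [hxy]
  exact key y ⟨hy.1, by linarith [hy.2]⟩

/-- The hypothesis concerns $[-\pi,\pi]$ only. A segment of length at most $2\pi$, translated to
start there, crosses $\pi$ at most once; since $p(-\pi)=p(\pi)$, splitting at $\pi$ doubles the
constant. -/
theorem IsLogHolderExponent.exists_oscillation {p : ℝ → ℝ} (hp : IsLogHolderExponent p) :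
    ∃ c : ℝ, 0 < c ∧ ∀ x y l, |x - y| ≤ l → 0 < l → l ≤ 2 * π →
      |1 / p x - 1 / p y| ≤ c / Real.log (Real.exp 1 + 1 / l) := by
  obtain ⟨c, hc, hlog⟩ := hp.logHolder
  have hpi := Real.pi_pos
  have hin : ∀ x ∈ Icc (-π) π, ∀ y ∈ Icc (-π) π, ∀ l, |x - y| ≤ l → 0 < l →
      |1 / p x - 1 / p y| ≤ c / Real.log (Real.exp 1 + 1 / l) := by
    intro x hx y hy l hl hl0
    by_cases hne : x = y
    · have := one_le_log_exp_add (t := 1 / l) (by positivity)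
      rw [hne, sub_self, abs_zero]; positivity
    · exact (hlog x hx y hy).trans (div_log_mono hc.le (abs_pos.mpr (sub_ne_zero.mpr hne)) hl)
  have hord : ∀ x y l, x ≤ y → y - x ≤ l → 0 < l → l ≤ 2 * π →
      |1 / p x - 1 / p y| ≤ 2 * c / Real.log (Real.exp 1 + 1 / l) := by
    intro x y l hxy hl hl0 hl1
    have hlog1 := one_le_log_exp_add (t := 1 / l) (by positivity)
    obtain ⟨n, hn, -⟩ := existsUnique_add_zsmul_mem_Ico Real.two_pi_pos x (-π)
    have hper : ∀ z, p (z + n • (2 * π)) = p z := fun z => hp.periodic.zsmul n z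
    rw [← hper x, ← hper y]
    set x' := x + n • (2 * π)
    set y' := y + n • (2 * π) with hy'
    have hd : y' - x' = y - x := by simp [x', y']
    have hx1 := hn.1
    have hx2 : x' < π := by linarith [hn.2]
    have h2 : 2 * c / Real.log (Real.exp 1 + 1 / l) =
      c / Real.log (Real.exp 1 + 1 / l) + c / Real.log (Real.exp 1 + 1 / l) := by ring
    rcases le_total y' π with hy | hy
    · have := hin x' ⟨hx1, hx2.le⟩ y' ⟨by linarith, hy⟩ l
        (by rw [abs_le]; constructor <;> linarith) hl0
      have h3 : 0 ≤ c / Real.log (Real.exp 1 + 1 / l) := by positivity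
      linarith
    · have h1 := hin x' ⟨hx1, hx2.le⟩ π ⟨by linarith, le_rfl⟩ l
        (by rw [abs_le]; constructor <;> linarith) hl0
      have h3 := hin (-π) ⟨le_rfl, by linarith⟩ (y' - 2 * π) ⟨by linarith, by linarith⟩ l
        (by rw [abs_le]; constructor <;> linarith) hl0
      have e1 : p (-π) = p π := by
        rw [← hp.periodic (-π)]; congr 1; ring
      rw [e1, hp.periodic.sub_eq] at h3
      rw [h2]
      calc _ = |(1 / p x' - 1 / p π) + (1 / p π - 1 / p y')| := by congr 1; ring
        _ ≤ _ := (abs_add_le _ _).trans (add_le_add h1 h3)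
  refine ⟨2 * c, by positivity, fun x y l hl hl0 hl1 => ?_⟩
  rcases le_total x y with h | h
  · exact hord x y l h (by linarith [(abs_le.mp hl).1]) hl0 hl1
  · rw [abs_sub_comm]
    exact hord y x l h (by linarith [(abs_le.mp hl).2]) hl0 hl1

/-- This is the exchange of exponents: $t^{q-q'}=e^{(q-q')\ln t}$, where the oscillation
$M^2c/\Lambda$ of the exponent compensates the size $L\Lambda$ of $\ln t$. -/
theorem rpow_le_exp_mul_rpow {M c L Λ t q q' : ℝ} (hq : 1 ≤ q) (hqM : q ≤ M) (hq' : 1 ≤ q')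
    (hqM' : q' ≤ M) (hΛ : 0 < Λ) (hqq : |1 / q - 1 / q'| ≤ c / Λ) (ht : 0 < t)
    (hL : |Real.log t| ≤ L * Λ) : t ^ q ≤ Real.exp (M ^ 2 * c * L) * t ^ q' := by
  rw [Real.rpow_def_of_pos ht, Real.rpow_def_of_pos ht, ← Real.exp_add]
  apply Real.exp_le_exp.mpr
  have h1 : |q - q'| ≤ M ^ 2 * (c / Λ) := by
    have : q - q' = -(q * q' * (1 / q - 1 / q')) := by field_simp; ring
    have hM0 : 0 ≤ M := by linarith
    rw [this, abs_neg, abs_mul, abs_of_pos (by positivity), sq]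
    gcongr
  have h2 : |Real.log t * (q - q')| ≤ L * Λ * (M ^ 2 * (c / Λ)) := by
    rw [abs_mul]
    gcongr
    exact (abs_nonneg _).trans hL
  have h3 : L * Λ * (M ^ 2 * (c / Λ)) = M ^ 2 * c * L := by field_simp
  have := (le_abs_self _).trans h2
  nlinarith

theorem harmonicMean_bounds {p : ℝ → ℝ} {M ε a b : ℝ} (hpm : AEMeasurable p volume)
    (hp1 : ∀ x, 1 ≤ p x) (hpM : ∀ x, p x ≤ M) (hab : a < b)
    (hosc : ∀ x ∈ Icc a b, ∀ y ∈ Icc a b, |1 / p x - 1 / p y| ≤ ε) :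
    1 ≤ harmonicMean p a b ∧ harmonicMean p a b ≤ M ∧
      ∀ x ∈ Icc a b, |1 / harmonicMean p a b - 1 / p x| ≤ ε := by
  have hl : 0 < b - a := by linarith
  have hM : 1 ≤ M := (hp1 0).trans (hpM 0)
  have hint : IntervalIntegrable (fun x => 1 / p x) volume a b := by
    refine (intervalIntegrable_const (c := (1 : ℝ))).mono_fun
      (hpm.const_div 1).aestronglyMeasurable.restrict (Filter.Eventually.of_forall fun x => ?_)
    have := hp1 x
    simp only [norm_one, Real.norm_eq_abs]
    rw [abs_of_pos (by positivity)]
    exact div_le_one_of_le₀ this (by linarith)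
  have avg : ∀ u v : ℝ, (∀ x ∈ Icc a b, u ≤ 1 / p x) → (∀ x ∈ Icc a b, 1 / p x ≤ v) →
      u ≤ (b - a)⁻¹ * ∫ x in a..b, 1 / p x ∧ (b - a)⁻¹ * ∫ x in a..b, 1 / p x ≤ v := by
    intro u v hu hv
    have h1 := intervalIntegral.integral_mono_on hab.le intervalIntegrable_const hint hu
    have h2 := intervalIntegral.integral_mono_on hab.le hint intervalIntegrable_const hv
    simp only [intervalIntegral.integral_const, smul_eq_mul] at h1 h2
    constructor
    · rw [le_inv_mul_iff₀ hl]; exact h1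
    · rw [inv_mul_le_iff₀ hl]; exact h2
  have h0 := avg (1 / M) 1
    (fun x _ => one_div_le_one_div_of_le (by linarith [hp1 x]) (hpM x))
    (fun x _ => div_le_one_of_le₀ (hp1 x) (by linarith [hp1 x]))
  have hpos : 0 < (b - a)⁻¹ * ∫ x in a..b, 1 / p x := lt_of_lt_of_le (by positivity) h0.1
  refine ⟨?_, ?_, fun x hx => ?_⟩
  · exact (one_le_inv₀ hpos).mpr h0.2
  · rw [harmonicMean, inv_le_comm₀ hpos (by linarith), ← one_div]; exact h0.1
  · have := avg (1 / p x - ε) (1 / p x + ε)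
      (fun y hy => by linarith [(abs_le.mp (hosc x hx y hy)).2])
      (fun y hy => by linarith [(abs_le.mp (hosc x hx y hy)).1])
    rw [harmonicMean, one_div, inv_inv, abs_le]
    constructor <;> linarith [this.1, this.2]

/-! ## Modulars and Luxemburg functionals -/

theorem expPow_ofReal {q : ℝ} (hq : 0 ≤ q) (t : ℝ≥0∞) : expPow (ENNReal.ofReal q) t = t ^ q := by
  simp [expPow, ENNReal.toReal_ofReal hq]

theorem expPow_mono (s : ℝ≥0∞) {t t' : ℝ≥0∞} (h : t ≤ t') : expPow s t ≤ expPow s t' := by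
  unfold expPow
  split_ifs with h1 h2 h3 h3
  · exact le_rfl
  · simp
  · exact absurd (h.trans h3) h2
  · exact le_rfl
  · exact ENNReal.rpow_le_rpow h ENNReal.toReal_nonneg

theorem modular_mono {B : Set ℝ} {s w g g' : ℝ → ℝ≥0∞} (h : ∀ x, g x ≤ g' x) :
    modular B s w g ≤ modular B s w g' :=
  lintegral_mono fun x => mul_le_mul_left (expPow_mono (s x) (h x)) _

theorem modular_le_one_of_luxemburg_lt {B : Set ℝ} {s w g : ℝ → ℝ≥0∞} {a : ℝ≥0}
    (h : luxemburg B s w g < a) : modular B s w (fun x => g x / a) ≤ 1 := by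
  simp only [luxemburg, iInf_lt_iff] at h
  obtain ⟨b, hb, hm, hba⟩ := h
  exact (modular_mono fun x => ENNReal.div_le_div_left hba.le _).trans hm

/-- A pointwise Young inequality. With $v=aw$, either $f^{q-1}v\ge1$ and then $f\le f^qv$, or $f\le
v^{-1/(q-1)}$, whose exponent is $q'/q$. For $q=1$ the second term is $0$ if $v\ge1$ and $\infty$
otherwise. -/
theorem le_rpow_mul_add_expPow {q : ℝ} (hq : 1 ≤ q) (f w : ℝ≥0∞) {a : ℝ≥0} (ha : 0 < a) :
    f ≤ a * (f ^ q * w) +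
      expPow ((if q = 1 then ∞ else ENNReal.ofReal (q / (q - 1))) / ENNReal.ofReal q)
        (w⁻¹ / a) := by
  have ha' : (a : ℝ≥0∞) ≠ 0 := by exact_mod_cast ha.ne'
  have hinv : w⁻¹ / a = (a * w)⁻¹ := by
    rw [ENNReal.mul_inv (Or.inl ha') (Or.inl ENNReal.coe_ne_top), div_eq_mul_inv, mul_comm]
  rw [hinv, show (a : ℝ≥0∞) * (f ^ q * w) = f ^ q * (a * w) by ring]
  generalize (a : ℝ≥0∞) * w = v
  by_cases h1 : q = 1
  · subst h1
    simp only [if_true, ENNReal.ofReal_one, div_one, expPow, ENNReal.rpow_one]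
    split_ifs with h
    · rw [add_zero]
      exact le_mul_of_one_le_right' (ENNReal.inv_le_one.mp h)
    · simp
  · have hq1 : 0 < q - 1 := by
      have := lt_of_le_of_ne hq (Ne.symm h1); linarith
    rw [if_neg h1, ← ENNReal.ofReal_div_of_pos (by linarith), expPow_ofReal (by positivity)]
    have e : q / (q - 1) / q = 1 / (q - 1) := by field_simp
    rw [e]
    rcases le_total 1 (f ^ (q - 1) * v) with h | h
    · refine le_add_right ?_
      rcases eq_or_ne f 0 with rfl | hf0
      · simp
      rcases eq_or_ne f ∞ with rfl | hf
      · rw [ENNReal.top_rpow_of_pos hq1] at h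
        rw [ENNReal.top_rpow_of_pos (by linarith)]
        have : v ≠ 0 := by rintro rfl; simp at h
        rw [ENNReal.top_mul this]
      · calc f = f * 1 := by rw [mul_one]
          _ ≤ f * (f ^ (q - 1) * v) := by gcongr
          _ = f ^ q * v := by
            rw [← mul_assoc]
            congr 1
            nth_rewrite 1 [← ENNReal.rpow_one f]
            rw [← ENNReal.rpow_add _ _ hf0 hf]
            congr 1; ring
    · refine le_add_left ?_
      rw [one_div, ENNReal.le_rpow_inv_iff hq1]
      rw [ENNReal.le_inv_iff_mul_le]
      exact h

/-- The substitute for Hölder's inequality: it needs only modulars, and the parameter $a$ balances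
the two terms. -/
theorem setLIntegral_le_modular {p : ℝ → ℝ} {ω f : ℝ → ℝ≥0∞} (hp : AEMeasurable p volume)
    (hp1 : ∀ x, 1 ≤ p x) (hω : AEMeasurable ω volume) (hf : AEMeasurable f volume) (B : Set ℝ)
    {a : ℝ≥0} (ha : 0 < a) :
    ∫⁻ x in B, f x ≤ a * (∫⁻ x in B, f x ^ p x * ω x) +
      modular B (fun x => dualExponent p x / ENNReal.ofReal (p x)) (fun _ => 1)
        (fun x => (ω x)⁻¹ / a) := by
  have hm : AEMeasurable (fun x => f x ^ p x * ω x) (volume.restrict B) :=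
    ((hf.pow hp).mul hω).restrict
  rw [modular, ← lintegral_const_mul'' _ hm, ← lintegral_add_left' (hm.const_mul _)]
  refine lintegral_mono fun x => ?_
  simp only [mul_one]
  exact le_rpow_mul_add_expPow (hp1 x) (f x) (ω x) ha

/-- The modular of `g` over one period. -/
def periodModular (p : ℝ → ℝ) (ω g : ℝ → ℝ≥0∞) : ℝ≥0∞ :=
  ∫⁻ x in Icc (-π) π, g x ^ p x * ω x

theorem periodModular_mono {p : ℝ → ℝ} {ω g g' : ℝ → ℝ≥0∞} (hp1 : ∀ x, 1 ≤ p x)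
    (h : ∀ x, g x ≤ g' x) : periodModular p ω g ≤ periodModular p ω g' :=
  lintegral_mono fun x => mul_le_mul_left
    (ENNReal.rpow_le_rpow (h x) (zero_le_one.trans (hp1 x))) _

theorem modular_eq_periodModular {p : ℝ → ℝ} (hp1 : ∀ x, 1 ≤ p x) (ω g : ℝ → ℝ≥0∞) :
    modular (Icc (-π) π) (fun x => ENNReal.ofReal (p x)) ω g = periodModular p ω g := by
  simp only [modular, periodModular, expPow_ofReal (zero_le_one.trans (hp1 _))]

/-- A norm inequality follows from the corresponding implication between unit modular balls. -/
theorem wNorm_le_mul {E F : Type*} [NormedAddCommGroup E] [NormedAddCommGroup F] {p : ℝ → ℝ}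
    {ω : ℝ → ℝ≥0∞} (hp1 : ∀ x, 1 ≤ p x) {f : ℝ → E} {g : ℝ → F} {K : ℝ≥0} (hK : 0 < K)
    (h : ∀ a : ℝ≥0, 0 < a → periodModular p ω (fun x => ‖g x‖ₑ / a) ≤ 1 →
      periodModular p ω (fun x => ‖f x‖ₑ / (K * a : ℝ≥0)) ≤ 1) :
    wNorm p ω f ≤ K * wNorm p ω g := by
  have hK0 : (K : ℝ≥0∞) ≠ 0 := by exact_mod_cast hK.ne'
  rw [mul_comm, ← ENNReal.div_le_iff hK0 ENNReal.coe_ne_top]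
  refine le_iInf fun a => le_iInf fun ha => le_iInf fun hm => ?_
  rw [ENNReal.div_le_iff hK0 ENNReal.coe_ne_top]
  rw [modular_eq_periodModular hp1] at hm
  have hm' := h a ha hm
  rw [← modular_eq_periodModular hp1] at hm'
  refine (iInf_le_of_le (K * a) (iInf_le_of_le (mul_pos hK ha) (iInf_le _ hm'))).trans ?_
  rw [ENNReal.coe_mul, mul_comm]

theorem wNorm_mono {E F : Type*} [NormedAddCommGroup E] [NormedAddCommGroup F] {p : ℝ → ℝ}
    {ω : ℝ → ℝ≥0∞} (hp1 : ∀ x, 1 ≤ p x) {f : ℝ → E} {g : ℝ → F} (h : ∀ x, ‖f x‖ₑ ≤ ‖g x‖ₑ) :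
    wNorm p ω f ≤ wNorm p ω g := by
  have := wNorm_le_mul (ω := ω) (f := f) (g := g) hp1 one_pos fun a _ hm =>
    (periodModular_mono hp1 fun x => by
      rw [one_mul]; exact ENNReal.div_le_div_right (h x) _).trans hm
  simpa using this

/-- A uniform modular bound gives a unit modular after division by a constant. -/
theorem periodModular_div_le {p : ℝ → ℝ} {ω g : ℝ → ℝ≥0∞} (hp1 : ∀ x, 1 ≤ p x) {K : ℝ≥0}
    (hK : 1 ≤ K) (h : periodModular p ω g ≤ K) :
    periodModular p ω (fun x => g x / K) ≤ 1 := by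
  have hK0 : (K : ℝ≥0∞) ≠ 0 := by
    have : 0 < K := one_pos.trans_le hK
    exact_mod_cast this.ne'
  have hK1 : (K : ℝ≥0∞)⁻¹ ≤ 1 := by
    rw [ENNReal.inv_le_one]; exact_mod_cast hK
  calc periodModular p ω (fun x => g x / K)
      ≤ ∫⁻ x in Icc (-π) π, (K : ℝ≥0∞)⁻¹ * (g x ^ p x * ω x) := by
        refine lintegral_mono fun x => ?_
        simp only
        rw [div_eq_mul_inv, ENNReal.mul_rpow_of_nonneg _ _ (zero_le_one.trans (hp1 x)),
          mul_comm (g x ^ p x), mul_assoc]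
        gcongr
        exact ENNReal.rpow_le_self_of_le_one hK1 (hp1 x)
    _ = (K : ℝ≥0∞)⁻¹ * periodModular p ω g :=
        lintegral_const_mul' _ _ (ENNReal.inv_ne_top.mpr hK0)
    _ ≤ (K : ℝ≥0∞)⁻¹ * K := by gcongr
    _ = 1 := ENNReal.inv_mul_cancel hK0 ENNReal.coe_ne_top

/-! ## Integrals of periodic functions -/

theorem setLIntegral_Ioc_eq_period {g : ℝ → ℝ≥0∞} (hg : Function.Periodic g (2 * π)) (t : ℝ) :
    ∫⁻ x in Ioc t (t + 2 * π), g x = ∫⁻ x in Icc (-π) π, g x := by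
  have h : ∀ s : ℝ, ∫⁻ x in Ioc t (t + 2 * π), g x = ∫⁻ x in Ioc s (s + 2 * π), g x := by
    intro s
    have : VAddInvariantMeasure (AddSubgroup.zmultiples (2 * π)) ℝ volume :=
      ⟨fun c s _ => measure_preimage_add _ _ _⟩
    exact (isAddFundamentalDomain_Ioc Real.two_pi_pos t).setLIntegral_eq
      (isAddFundamentalDomain_Ioc Real.two_pi_pos s) g hg.map_vadd_zmultiples
  rw [h (-π), show -π + 2 * π = π by ring]
  exact setLIntegral_congr Ioc_ae_eq_Icc

theorem setLIntegral_Ioo_le_period {g : ℝ → ℝ≥0∞} (hg : Function.Periodic g (2 * π)) {a b : ℝ}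
    (hab : b - a ≤ 2 * π) : ∫⁻ x in Ioo a b, g x ≤ ∫⁻ x in Icc (-π) π, g x := by
  rw [← setLIntegral_Ioc_eq_period hg a]
  exact lintegral_mono_set fun x hx => ⟨hx.1, by linarith [hx.2]⟩

theorem setLIntegral_Ioc_eq_nsmul_period {g : ℝ → ℝ≥0∞} (hg : Function.Periodic g (2 * π))
    (n : ℕ) (t : ℝ) :
    ∫⁻ x in Ioc t (t + n * (2 * π)), g x = n * ∫⁻ x in Icc (-π) π, g x := by
  induction n with
  | zero => simp
  | succ n ih =>
    have hpi := Real.pi_pos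
    have hn : (0 : ℝ) ≤ n * (2 * π) := by positivity
    rw [← Ioc_union_Ioc_eq_Ioc (b := t + n * (2 * π)) (by linarith) (by push_cast; linarith),
      lintegral_union measurableSet_Ioc (Ioc_disjoint_Ioc_of_le le_rfl), ih,
      show t + ((n + 1 : ℕ) : ℝ) * (2 * π) = t + n * (2 * π) + 2 * π by push_cast; ring,
      setLIntegral_Ioc_eq_period hg]
    push_cast; ring

/-! ## The Muckenhoupt condition on a single interval -/

variable {p : ℝ → ℝ} {ω : ℝ → ℝ≥0∞}

theorem setLIntegral_Ioo_pos (hω : IsPeriodicWeight ω) {a b : ℝ} (hab : a < b) :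
    0 < ∫⁻ x in Ioo a b, ω x := by
  rw [pos_iff_ne_zero]
  intro h
  rw [lintegral_eq_zero_iff' hω.aemeasurable.restrict] at h
  have h2 : ∀ᵐ x ∂volume.restrict (Ioo a b), False := by
    filter_upwards [h, ae_restrict_of_ae hω.pos] with x hx1 hx2
    exact hx2.ne' hx1
  rw [Filter.eventually_false_iff_eq_bot, ae_eq_bot, Measure.restrict_eq_zero,
    Real.volume_Ioo, ENNReal.ofReal_eq_zero] at h2
  linarith

theorem muckenhoupt_le (p : ℝ → ℝ) (ω : ℝ → ℝ≥0∞) {a b : ℝ} (hab : a < b) (hl : b - a ≤ 2 * π) :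
    (∫⁻ x in Ioo a b, ω x) / ENNReal.ofReal ((b - a) ^ harmonicMean p a b) *
      luxemburg (Ioo a b) (fun x => dualExponent p x / ENNReal.ofReal (p x)) (fun _ => 1)
        (fun x => (ω x)⁻¹) ≤ muckenhouptConst p ω :=
  le_iSup_of_le a (le_iSup_of_le b (le_iSup_of_le hab (le_iSup_of_le hl le_rfl)))

/-- On every interval there is a constant which nearly realizes the Muckenhoupt condition. -/
theorem IsMuckenhoupt.exists_modular_le (hω : IsMuckenhoupt p ω) {a b : ℝ} (hab : a < b)
    (hl : b - a ≤ 2 * π) (hfin : ∫⁻ x in Ioo a b, ω x ≠ ∞) :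
    ∃ c : ℝ≥0, 0 < c ∧
      modular (Ioo a b) (fun x => dualExponent p x / ENNReal.ofReal (p x)) (fun _ => 1)
        (fun x => (ω x)⁻¹ / c) ≤ 1 ∧
      c * ((∫⁻ x in Ioo a b, ω x) / ENNReal.ofReal ((b - a) ^ harmonicMean p a b)) ≤
        muckenhouptConst p ω + 1 := by
  have hm := muckenhoupt_le p ω hab hl
  have hl0 : 0 < b - a := sub_pos.mpr hab
  have hX0 : (∫⁻ x in Ioo a b, ω x) / ENNReal.ofReal ((b - a) ^ harmonicMean p a b) ≠ 0 :=
    ENNReal.div_ne_zero.mpr ⟨(setLIntegral_Ioo_pos hω.weight hab).ne', ENNReal.ofReal_ne_top⟩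
  have hX1 : (∫⁻ x in Ioo a b, ω x) / ENNReal.ofReal ((b - a) ^ harmonicMean p a b) ≠ ∞ :=
    ENNReal.div_ne_top hfin (by simpa using Real.rpow_pos_of_pos hl0 _)
  have hK := hω.const_lt_top
  set X := (∫⁻ x in Ioo a b, ω x) / ENNReal.ofReal ((b - a) ^ harmonicMean p a b)
  -- The added 1 makes the inequality strict, so a finite positive $c$ fits in between even if the
  -- infimum is not attained or vanishes.
  have h1 : luxemburg (Ioo a b) (fun x => dualExponent p x / ENNReal.ofReal (p x)) (fun _ => 1)
        (fun x => (ω x)⁻¹) < (muckenhouptConst p ω + 1) / X := by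
    rw [ENNReal.lt_div_iff_mul_lt (Or.inl hX0) (Or.inl hX1), mul_comm]
    exact hm.trans_lt (ENNReal.lt_add_right hK.ne one_ne_zero)
  obtain ⟨c, hc1, hc2⟩ := ENNReal.lt_iff_exists_nnreal_btwn.mp h1
  refine ⟨c, ?_, modular_le_one_of_luxemburg_lt hc1, ?_⟩
  · exact ENNReal.coe_pos.mp (bot_le.trans_lt hc1)
  · exact (ENNReal.le_div_iff_mul_le (Or.inl hX0) (Or.inl hX1)).mp hc2.le

theorem periodic_rpow_mul (hp : Function.Periodic p (2 * π)) (hω : Function.Periodic ω (2 * π))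
    {f : ℝ → ℝ≥0∞} (hf : Function.Periodic f (2 * π)) :
    Function.Periodic (fun x => f x ^ p x * ω x) (2 * π) := fun x => by
  simp only [hp x, hω x, hf x]

theorem setLIntegral_Ioo_period (g : ℝ → ℝ≥0∞) :
    ∫⁻ x in Ioo (-π) π, g x = ∫⁻ x in Icc (-π) π, g x :=
  setLIntegral_congr Ioo_ae_eq_Icc

/-- The unit modular ball is bounded in $L^1$ of a period. This caps $\ln\int_Bf$ from above when
exponents are exchanged. -/
theorem exists_lintegral_period_le (hp : IsLogHolderExponent p) (hω : IsMuckenhoupt p ω)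
    (hfin : ∫⁻ x in Icc (-π) π, ω x ≠ ∞) :
    ∃ D : ℝ, 1 ≤ D ∧ ∀ f : ℝ → ℝ≥0∞, AEMeasurable f volume → periodModular p ω f ≤ 1 →
      ∫⁻ x in Icc (-π) π, f x ≤ ENNReal.ofReal D := by
  have hpi := Real.pi_pos
  obtain ⟨c, hc, hm, -⟩ := hω.exists_modular_le (a := -π) (b := π) (by linarith) (by linarith)
    (by rwa [setLIntegral_Ioo_period])
  refine ⟨c + 1, by simp, fun f hf hf1 => ?_⟩
  have h := setLIntegral_le_modular hp.aemeasurable hp.one_le hω.weight.aemeasurable hf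
    (Ioo (-π) π) hc
  rw [setLIntegral_Ioo_period, setLIntegral_Ioo_period] at h
  calc _ ≤ _ := h
    _ ≤ (c : ℝ≥0∞) * 1 + 1 := by gcongr; exact hf1
    _ = ENNReal.ofReal (c + 1) := by
      rw [ENNReal.ofReal_add (by positivity) zero_le_one]; simp

/-- The single interval estimate behind the boundedness of averages. -/
theorem exists_average_rpow_le (hp : IsLogHolderExponent p) (hω : IsMuckenhoupt p ω)
    (hfin : ∫⁻ x in Icc (-π) π, ω x ≠ ∞) :
    ∃ C : ℝ≥0, ∀ f : ℝ → ℝ≥0∞, AEMeasurable f volume → Function.Periodic f (2 * π) →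
      periodModular p ω f ≤ 1 → ∀ a b : ℝ, a < b → b - a ≤ 2 * π →
      ENNReal.ofReal (b - a) ≤ ∫⁻ y in Ioo a b, f y → ∀ x ∈ Icc a b,
      ((∫⁻ y in Ioo a b, f y) / ENNReal.ofReal (b - a)) ^ p x * (∫⁻ y in Ioo a b, ω y) ≤
        C * ∫⁻ y in Ioo a b, f y ^ p y * ω y := by
  obtain ⟨M, hM, hpM⟩ := hp.exists_le
  obtain ⟨κ, hκ, hosc⟩ := hp.exists_oscillation
  obtain ⟨D, hD, hfD⟩ := exists_lintegral_period_le hp hω hfin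
  have hp1 := hp.one_le
  set L := 1 + Real.log D with hL
  have hlogD : 0 ≤ Real.log D := Real.log_nonneg hD
  set C₀ := Real.exp (M ^ 2 * κ * L) with hC₀
  have hC₀0 : 0 < C₀ := Real.exp_pos _
  obtain ⟨K, hK⟩ := WithTop.ne_top_iff_exists.mp hω.const_lt_top.ne
  refine ⟨(C₀ * C₀ * 2 ^ M).toNNReal * (K + 1), fun f hf hfper hf1 a b hab hl hS x hx => ?_⟩
  set l := b - a with hldef
  have hl0 : 0 < l := sub_pos.mpr hab
  set Λ := Real.log (Real.exp 1 + 1 / l) with hΛ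
  have hΛ1 : 1 ≤ Λ := one_le_log_exp_add (by positivity)
  have hΛ0 : 0 < Λ := by linarith
  have hlogl : -Real.log l ≤ Λ := by
    rw [← Real.log_inv, ← one_div]
    exact Real.log_le_log (by positivity) (by linarith [Real.exp_pos 1])
  have hoscQ : ∀ x ∈ Icc a b, ∀ y ∈ Icc a b, |1 / p x - 1 / p y| ≤ κ / Λ := fun x hx y hy =>
    hosc x y l (by rw [abs_le]; constructor <;> linarith [hx.1, hx.2, hy.1, hy.2]) hl0 hl
  obtain ⟨hq1, hqM, hq⟩ := harmonicMean_bounds hp.aemeasurable hp1 hpM hab hoscQ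
  have hWfin : ∫⁻ y in Ioo a b, ω y ≠ ∞ :=
    ne_top_of_le_ne_top hfin (setLIntegral_Ioo_le_period hω.weight.periodic hl)
  obtain ⟨c, hc0, hcm, hcK⟩ := hω.exists_modular_le hab hl hWfin
  set q := harmonicMean p a b
  set W := ∫⁻ y in Ioo a b, ω y
  set I := ∫⁻ y in Ioo a b, f y ^ p y * ω y
  have hSD : ∫⁻ y in Ioo a b, f y ≤ ENNReal.ofReal D :=
    (setLIntegral_Ioo_le_period hfper hl).trans (hfD f hf hf1)
  obtain ⟨S, hS0, hSeq⟩ : ∃ S : ℝ, 0 < S ∧ ∫⁻ y in Ioo a b, f y = ENNReal.ofReal S := by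
    have h1 := ne_top_of_le_ne_top ENNReal.ofReal_ne_top hSD
    refine ⟨_, ENNReal.toReal_pos ?_ h1, (ENNReal.ofReal_toReal h1).symm⟩
    exact ((ENNReal.ofReal_pos.mpr hl0).trans_le hS).ne'
  rw [hSeq] at hS hSD ⊢
  have hlS : l ≤ S := (ENNReal.ofReal_le_ofReal_iff hS0.le).mp hS
  have hSD' : S ≤ D := (ENNReal.ofReal_le_ofReal_iff (by linarith)).mp hSD
  have hlogS1 : Real.log S ≤ Real.log D := Real.log_le_log hS0 hSD'
  have hlogS2 : Real.log l ≤ Real.log S := Real.log_le_log hl0 hlS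
  -- From $l\le S\le D$ and $-\ln l\le\Lambda$, both $|\ln S|$ and $|\ln(S/l)|$ are at most $\ln
  -- D+\Lambda$. The lower bound on $S$ is where the average of $f$ being at least 1 is used.
  have hLΛ : Real.log D + Λ ≤ L * Λ := by rw [hL]; nlinarith
  -- the exponents `p y` may be replaced by `q` up to constants
  have e1 : ∀ y ∈ Ioo a b, (1 / S) ^ p y ≤ C₀ * (1 / S) ^ q := fun y hy =>
    rpow_le_exp_mul_rpow (hp1 y) (hpM y) hq1 hqM hΛ0
      (by rw [abs_sub_comm]; exact hq y (Ioo_subset_Icc_self hy)) (by positivity)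
      (by rw [one_div, Real.log_inv, abs_neg, abs_le]; constructor <;> linarith)
  have e2 : (S / l) ^ p x ≤ C₀ * (S / l) ^ q :=
    rpow_le_exp_mul_rpow (hp1 x) (hpM x) hq1 hqM hΛ0
      (by rw [abs_sub_comm]; exact hq x hx) (by positivity)
      (by rw [Real.log_div hS0.ne' hl0.ne', abs_le]; constructor <;> linarith)
  -- lower bound for the modular
  have h2 : 1 ≤ c * (ENNReal.ofReal (2 ^ M * (C₀ * (1 / S) ^ q)) * I) := by
    -- Scaling $f$ to have integral 2 leaves at least 1 for the first term, because the dual modular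
    -- takes at most 1.
    have h := setLIntegral_le_modular (f := fun y => ENNReal.ofReal (2 / S) * f y) hp.aemeasurable
      hp1 hω.weight.aemeasurable (hf.const_mul _) (Ioo a b) hc0
    rw [lintegral_const_mul' _ _ ENNReal.ofReal_ne_top, hSeq,
      ← ENNReal.ofReal_mul (by positivity), div_mul_cancel₀ _ hS0.ne'] at h
    have h' : (1 : ℝ≥0∞) + 1 ≤
        c * (∫⁻ y in Ioo a b, (ENNReal.ofReal (2 / S) * f y) ^ p y * ω y) + 1 := by
      calc (1 : ℝ≥0∞) + 1 = ENNReal.ofReal 2 := by norm_num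
        _ ≤ _ := h
        _ ≤ _ := by gcongr
    have h'' := (ENNReal.add_le_add_iff_right ENNReal.one_ne_top).mp h'
    refine h''.trans ?_
    gcongr
    rw [← lintegral_const_mul' _ _ ENNReal.ofReal_ne_top]
    refine setLIntegral_mono' measurableSet_Ioo fun y hy => ?_
    rw [← mul_assoc]
    gcongr
    rw [ENNReal.mul_rpow_of_nonneg _ _ (zero_le_one.trans (hp1 y)),
      ENNReal.ofReal_rpow_of_pos (by positivity)]
    gcongr
    rw [show 2 / S = 2 * (1 / S) by ring, Real.mul_rpow (by norm_num) (by positivity)]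
    have := e1 y hy
    have h3 : (2 : ℝ) ^ p y ≤ 2 ^ M := Real.rpow_le_rpow_of_exponent_le (by norm_num) (hpM y)
    gcongr
  rw [← ENNReal.ofReal_div_of_pos hl0, ENNReal.ofReal_rpow_of_pos (by positivity)]
  -- Multiplying by the lower bound `h2` cancels $S^q$ and leaves $cW/l^q$, which the choice of $c$
  -- controls.
  calc ENNReal.ofReal ((S / l) ^ p x) * W
      ≤ ENNReal.ofReal (C₀ * (S / l) ^ q) * W * 1 := by rw [mul_one]; gcongr
    _ ≤ ENNReal.ofReal (C₀ * (S / l) ^ q) * W *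
          (c * (ENNReal.ofReal (2 ^ M * (C₀ * (1 / S) ^ q)) * I)) := by gcongr
    _ = ENNReal.ofReal (C₀ * C₀ * 2 ^ M) * (c * (W / ENNReal.ofReal (l ^ q))) * I := by
        rw [ENNReal.div_eq_inv_mul, ← ENNReal.ofReal_inv_of_pos (by positivity)]
        have : C₀ * (S / l) ^ q * (2 ^ M * (C₀ * (1 / S) ^ q)) =
            C₀ * C₀ * 2 ^ M * (l ^ q)⁻¹ := by
          rw [Real.div_rpow hS0.le hl0.le, Real.div_rpow zero_le_one hS0.le, Real.one_rpow]
          field_simp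
        calc _ = ENNReal.ofReal (C₀ * (S / l) ^ q) *
              ENNReal.ofReal (2 ^ M * (C₀ * (1 / S) ^ q)) * (c * W * I) := by ring
          _ = ENNReal.ofReal (C₀ * C₀ * 2 ^ M) * ENNReal.ofReal (l ^ q)⁻¹ * (c * W * I) := by
            rw [← ENNReal.ofReal_mul (by positivity), this, ENNReal.ofReal_mul (by positivity)]
          _ = _ := by ring
    _ ≤ ENNReal.ofReal (C₀ * C₀ * 2 ^ M) * (muckenhouptConst p ω + 1) * I := by gcongr
    _ = _ := by rw [← hK]; rfl

/-! ## Boundedness of averages -/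

/-- The average of `f` over `(x - h, x + h)`. -/
def ballAverage (h : ℝ) (f : ℝ → ℝ≥0∞) (x : ℝ) : ℝ≥0∞ :=
  (∫⁻ y in Ioo (x - h) (x + h), f y) / ENNReal.ofReal (2 * h)

theorem measurable_setLIntegral_ball {g : ℝ → ℝ≥0∞} (hg : AEMeasurable g volume) :
    Measurable fun z : ℝ × ℝ => ∫⁻ y in Ioo (z.1 - z.2) (z.1 + z.2), g y := by
  have h : ∀ z : ℝ × ℝ, ∫⁻ y in Ioo (z.1 - z.2) (z.1 + z.2), g y =
      ∫⁻ y, ({w : (ℝ × ℝ) × ℝ | w.1.1 - w.1.2 < w.2 ∧ w.2 < w.1.1 + w.1.2}.indicator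
        (fun w => hg.mk g w.2)) (z, y) := by
    intro z
    rw [lintegral_congr_ae (ae_restrict_of_ae hg.ae_eq_mk), ← lintegral_indicator measurableSet_Ioo]
    rfl
  simp_rw [h]
  refine Measurable.lintegral_prod_right' ?_
  refine Measurable.indicator (hg.measurable_mk.comp measurable_snd) ?_
  have h1 : Measurable fun w : (ℝ × ℝ) × ℝ => w.1.1 - w.1.2 := by fun_prop
  have h2 : Measurable fun w : (ℝ × ℝ) × ℝ => w.1.1 + w.1.2 := by fun_prop
  exact (measurableSet_lt h1 measurable_snd).inter (measurableSet_lt measurable_snd h2)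

/-- Cut $(y-h,y+h)$ at $y$. For $x$ in either half, that half lies inside $(x-h,x+h)$, so the
denominator is at least its mass and each half contributes at most 1. No doubling property is
needed. -/
theorem lintegral_weight_div_le (hω : IsPeriodicWeight ω)
    {h : ℝ} (hh : 0 < h) (hhπ : h ≤ π) (y : ℝ) :
    ∫⁻ x in Ioo (y - h) (y + h), ω x / ∫⁻ t in Ioo (x - h) (x + h), ω t ≤ 2 := by
  have hhalf : ∀ a b : ℝ, a < b → b - a ≤ 2 * π →
      (∀ x ∈ Ioo a b, Ioo a b ⊆ Ioo (x - h) (x + h)) →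
      ∫⁻ x in Ioo a b, ω x / ∫⁻ t in Ioo (x - h) (x + h), ω t ≤ 1 := by
    intro a b hab hl hsub
    calc _ ≤ ∫⁻ x in Ioo a b, ω x * (∫⁻ t in Ioo a b, ω t)⁻¹ := by
          refine setLIntegral_mono' measurableSet_Ioo fun x hx => ?_
          rw [div_eq_mul_inv]
          exact mul_le_mul_right (ENNReal.inv_le_inv.mpr (lintegral_mono_set (hsub x hx))) _
      _ = (∫⁻ x in Ioo a b, ω x) / (∫⁻ x in Ioo a b, ω x) := by
          rw [lintegral_mul_const'' _ hω.aemeasurable.restrict, div_eq_mul_inv]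
      _ ≤ 1 := ENNReal.div_self_le_one
  have hpi := Real.pi_pos
  have hsplit : Ioo (y - h) (y + h) ⊆ Ioc (y - h) y ∪ Ioo y (y + h) := fun x hx => by
    rcases le_or_gt x y with h1 | h1
    · exact Or.inl ⟨hx.1, h1⟩
    · exact Or.inr ⟨h1, hx.2⟩
  calc _ ≤ ∫⁻ x in Ioc (y - h) y ∪ Ioo y (y + h), ω x / ∫⁻ t in Ioo (x - h) (x + h), ω t :=
        lintegral_mono_set hsplit
    _ ≤ (∫⁻ x in Ioc (y - h) y, ω x / ∫⁻ t in Ioo (x - h) (x + h), ω t) +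
        ∫⁻ x in Ioo y (y + h), ω x / ∫⁻ t in Ioo (x - h) (x + h), ω t := lintegral_union_le _ _ _
    _ ≤ 1 + 1 := by
      refine add_le_add ?_ ?_
      · rw [setLIntegral_congr Ioo_ae_eq_Ioc.symm]
        exact hhalf _ _ (by linarith) (by linarith) fun x hx t ht =>
          ⟨by linarith [hx.2, ht.1], by linarith [hx.1, ht.2]⟩
      · exact hhalf _ _ (by linarith) (by linarith) fun x hx t ht =>
          ⟨by linarith [hx.2, ht.1], by linarith [hx.1, ht.2]⟩
    _ = 2 := by norm_num

/-- If $\omega$ has infinite mass on the period, a finite Muckenhoupt constant forces the dual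
Luxemburg functional to vanish. Young's inequality for $nf$ with $a=n^{-M}$ then gives $n\int f\le2$
for every $n\ge1$. -/
theorem lintegral_eq_zero_of_weight_top (hp : IsLogHolderExponent p) (hω : IsMuckenhoupt p ω)
    (htop : ∫⁻ x in Icc (-π) π, ω x = ∞) {f : ℝ → ℝ≥0∞} (hf : AEMeasurable f volume)
    (hf1 : periodModular p ω f ≤ 1) : ∫⁻ x in Icc (-π) π, f x = 0 := by
  have hpi := Real.pi_pos
  obtain ⟨M, hM, hpM⟩ := hp.exists_le
  have hlux : luxemburg (Ioo (-π) π) (fun x => dualExponent p x / ENNReal.ofReal (p x))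
      (fun _ => 1) (fun x => (ω x)⁻¹) = 0 := by
    have h := (muckenhoupt_le p ω (a := -π) (b := π) (by linarith) (by linarith)).trans_lt
      hω.const_lt_top
    rw [setLIntegral_Ioo_period, htop, ENNReal.top_div_of_ne_top ENNReal.ofReal_ne_top] at h
    by_contra h0
    rw [ENNReal.top_mul h0] at h
    exact lt_irrefl _ h
  have key : ∀ n : ℕ, 1 ≤ n → (n : ℝ≥0∞) * ∫⁻ x in Icc (-π) π, f x ≤ 2 := by
    intro n hn
    have hn' : (1 : ℝ≥0∞) ≤ n := by exact_mod_cast hn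
    have hnp : (0 : ℝ≥0) < (n : ℝ≥0) ^ M := NNReal.rpow_pos (by positivity)
    have hc : 0 < ((n : ℝ≥0) ^ M)⁻¹ := by positivity
    have h := setLIntegral_le_modular (f := fun y => (n : ℝ≥0∞) * f y) hp.aemeasurable
      hp.one_le hω.weight.aemeasurable (hf.const_mul _) (Ioo (-π) π) hc
    rw [lintegral_const_mul' _ _ (ENNReal.natCast_ne_top n), setLIntegral_Ioo_period,
      setLIntegral_Ioo_period] at h
    have hm : ∫⁻ x in Icc (-π) π, ((n : ℝ≥0∞) * f x) ^ p x * ω x ≤ (n : ℝ≥0∞) ^ M * 1 := by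
      refine le_trans ?_ (mul_le_mul_right hf1 _)
      rw [periodModular, ← lintegral_const_mul' _ _
        (ENNReal.rpow_ne_top_of_nonneg (by linarith) (ENNReal.natCast_ne_top n))]
      refine lintegral_mono fun x => ?_
      simp only
      rw [ENNReal.mul_rpow_of_nonneg _ _ (zero_le_one.trans (hp.one_le x)), mul_assoc]
      gcongr
      exact hpM x
    have hcn : ((((n : ℝ≥0) ^ M)⁻¹ : ℝ≥0) : ℝ≥0∞) * ((n : ℝ≥0∞) ^ M * 1) = 1 := by
      rw [mul_one, show (n : ℝ≥0∞) ^ M = (((n : ℝ≥0) ^ M : ℝ≥0) : ℝ≥0∞) by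
        rw [ENNReal.coe_rpow_of_nonneg _ (by linarith)]; simp, ← ENNReal.coe_mul,
        inv_mul_cancel₀ hnp.ne', ENNReal.coe_one]
    calc _ ≤ _ := h
      _ ≤ ((((n : ℝ≥0) ^ M)⁻¹ : ℝ≥0) : ℝ≥0∞) * ((n : ℝ≥0∞) ^ M * 1) + 1 := by
        gcongr
        exact modular_le_one_of_luxemburg_lt (by rw [hlux]; exact_mod_cast hc)
      _ = 2 := by rw [hcn]; norm_num
  by_contra h0
  obtain ⟨n, hn⟩ := ENNReal.exists_nat_mul_gt h0 (b := 2) (by norm_num)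
  rcases Nat.eq_zero_or_pos n with rfl | hn1
  · simp at hn
  · exact absurd (key n hn1) (not_le.mpr hn)

theorem ballAverage_le_of_period_eq_zero {f : ℝ → ℝ≥0∞} (hper : Function.Periodic f (2 * π))
    (h0 : ∫⁻ x in Icc (-π) π, f x = 0) {h : ℝ} (hhπ : h ≤ π) (x : ℝ) :
    ballAverage h f x = 0 := by
  have : ∫⁻ y in Ioo (x - h) (x + h), f y ≤ 0 :=
    (setLIntegral_Ioo_le_period hper (by linarith)).trans h0.le
  rw [ballAverage, le_antisymm this bot_le, ENNReal.zero_div]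

theorem aemeasurable_fst {α β γ : Type*} [MeasurableSpace α] [MeasurableSpace β]
    [MeasurableSpace γ] {μ : Measure α} {ν : Measure β} [SFinite ν] {f : α → γ}
    (hf : AEMeasurable f μ) : AEMeasurable (fun z : α × β => f z.1) (μ.prod ν) :=
  hf.comp_quasiMeasurePreserving Measure.quasiMeasurePreserving_fst

theorem aemeasurable_snd {α β γ : Type*} [MeasurableSpace α] [MeasurableSpace β]
    [MeasurableSpace γ] {μ : Measure α} {ν : Measure β} [SFinite ν] {f : β → γ}
    (hf : AEMeasurable f ν) : AEMeasurable (fun z : α × β => f z.2) (μ.prod ν) :=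
  hf.comp_quasiMeasurePreserving Measure.quasiMeasurePreserving_snd

/-- After Tonelli the integral in $x$ is at most 2 by `lintegral_weight_div_le`. The variable $y$
ranges over two periods, hence the 4. -/
theorem lintegral_weighted_ball_le (hω : IsPeriodicWeight ω)
    {Φ : ℝ → ℝ≥0∞} (hΦ : AEMeasurable Φ volume)
    (hper : Function.Periodic Φ (2 * π)) {h : ℝ} (hh : 0 < h) (hhπ : h ≤ π) :
    ∫⁻ x in Icc (-π) π, (ω x / ∫⁻ t in Ioo (x - h) (x + h), ω t) *
      (∫⁻ y in Ioo (x - h) (x + h), Φ y) ≤ 4 * ∫⁻ x in Icc (-π) π, Φ x := by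
  have hpi := Real.pi_pos
  set V : ℝ → ℝ≥0∞ := fun x => ω x / ∫⁻ t in Ioo (x - h) (x + h), ω t with hV
  have hVm : AEMeasurable V volume := by
    refine hω.aemeasurable.div (Measurable.aemeasurable ?_)
    exact (measurable_setLIntegral_ball hω.aemeasurable).comp
      (measurable_id.prodMk (measurable_const (a := h)))
  set A : Set (ℝ × ℝ) := {z | |z.1 - z.2| < h} with hA
  have hAm : MeasurableSet A := measurableSet_lt (by fun_prop) measurable_const
  have hinA : ∀ x y : ℝ, (x, y) ∈ A ↔ y ∈ Ioo (x - h) (x + h) := fun x y => by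
    simp only [hA, mem_ofPred_eq, mem_Ioo, abs_lt]
    constructor <;> rintro ⟨h1, h2⟩ <;> constructor <;> linarith
  have hinA' : ∀ x y : ℝ, (x, y) ∈ A ↔ x ∈ Ioo (y - h) (y + h) := fun x y => by
    simp only [hA, mem_ofPred_eq, mem_Ioo, abs_lt]
    constructor <;> rintro ⟨h1, h2⟩ <;> constructor <;> linarith
  set G : ℝ → ℝ → ℝ≥0∞ := fun x y => A.indicator (fun z => V z.1 * Φ z.2) (x, y) with hG
  have hGm : AEMeasurable (Function.uncurry G)
      ((volume.restrict (Icc (-π) π)).prod (volume.restrict (Icc (-(2 * π)) (2 * π)))) := by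
    refine AEMeasurable.indicator ?_ hAm
    exact (aemeasurable_fst hVm.restrict).mul (aemeasurable_snd hΦ.restrict)
  calc _ = ∫⁻ x in Icc (-π) π, ∫⁻ y in Icc (-(2 * π)) (2 * π), G x y := by
        refine setLIntegral_congr_fun measurableSet_Icc fun x hx => ?_
        have hsub : Ioo (x - h) (x + h) ⊆ Icc (-(2 * π)) (2 * π) := fun y hy =>
          ⟨by linarith [hy.1, hx.1], by linarith [hy.2, hx.2]⟩
        have h1 : ∀ y, G x y = (Ioo (x - h) (x + h)).indicator (fun y => V x * Φ y) y := by
          intro y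
          by_cases hy : y ∈ Ioo (x - h) (x + h)
          · simp only [hG]
            rw [indicator_of_mem hy, indicator_of_mem ((hinA x y).mpr hy)]
          · simp only [hG]
            rw [indicator_of_notMem hy, indicator_of_notMem (fun hc => hy ((hinA x y).mp hc))]
        simp only [h1]
        rw [lintegral_indicator measurableSet_Ioo, Measure.restrict_restrict measurableSet_Ioo,
          inter_eq_left.mpr hsub, lintegral_const_mul'' _ hΦ.restrict]
    _ = ∫⁻ y in Icc (-(2 * π)) (2 * π), ∫⁻ x in Icc (-π) π, G x y := lintegral_lintegral_swap hGm
    _ ≤ ∫⁻ y in Icc (-(2 * π)) (2 * π), 2 * Φ y := by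
        refine lintegral_mono fun y => ?_
        have h1 : ∀ x, G x y = (Ioo (y - h) (y + h)).indicator (fun x => V x * Φ y) x := by
          intro x
          by_cases hx : x ∈ Ioo (y - h) (y + h)
          · simp only [hG]
            rw [indicator_of_mem hx, indicator_of_mem ((hinA' x y).mpr hx)]
          · simp only [hG]
            rw [indicator_of_notMem hx, indicator_of_notMem (fun hc => hx ((hinA' x y).mp hc))]
        simp only [h1]
        calc _ ≤ ∫⁻ x, (Ioo (y - h) (y + h)).indicator (fun x => V x * Φ y) x :=
              setLIntegral_le_lintegral _ _
          _ = (∫⁻ x in Ioo (y - h) (y + h), V x) * Φ y := by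
              rw [lintegral_indicator measurableSet_Ioo, lintegral_mul_const'' _ hVm.restrict]
          _ ≤ 2 * Φ y := by
              gcongr
              exact lintegral_weight_div_le hω hh hhπ y
    _ = 2 * ∫⁻ y in Icc (-(2 * π)) (2 * π), Φ y := lintegral_const_mul'' _ hΦ.restrict
    _ = 4 * ∫⁻ x in Icc (-π) π, Φ x := by
        rw [setLIntegral_congr (Ioc_ae_eq_Icc (a := -(2 * π)) (b := 2 * π)).symm]
        have := setLIntegral_Ioc_eq_nsmul_period hper 2 (-(2 * π))
        rw [show -(2 * π) + ((2 : ℕ) : ℝ) * (2 * π) = 2 * π by push_cast; ring] at this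
        rw [this, ← mul_assoc]
        norm_num

/-- Averages over balls of a fixed radius are bounded on the weighted space, uniformly in the
radius. -/
theorem exists_periodModular_ballAverage_le (hp : IsLogHolderExponent p)
    (hω : IsMuckenhoupt p ω) :
    ∃ K : ℝ≥0, 1 ≤ K ∧ ∀ f : ℝ → ℝ≥0∞, AEMeasurable f volume → Function.Periodic f (2 * π) →
      periodModular p ω f ≤ 1 → ∀ h : ℝ, 0 < h → h ≤ π →
      periodModular p ω (fun x => ballAverage h f x / K) ≤ 1 := by
  have hp1 := hp.one_le
  by_cases hfin : ∫⁻ x in Icc (-π) π, ω x = ∞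
  · refine ⟨1, le_rfl, fun f hf hper hf1 h hh hhπ => ?_⟩
    have h0 := lintegral_eq_zero_of_weight_top hp hω hfin hf hf1
    refine periodModular_div_le hp1 le_rfl ?_
    have : ∀ x, ballAverage h f x ^ p x * ω x = 0 := fun x => by
      rw [ballAverage_le_of_period_eq_zero hper h0 hhπ,
        ENNReal.zero_rpow_of_pos (one_pos.trans_le (hp1 x)), zero_mul]
    simp [periodModular, this]
  obtain ⟨C, hC⟩ := exists_average_rpow_le hp hω hfin
  obtain ⟨Ω, hΩ⟩ := WithTop.ne_top_iff_exists.mp hfin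
  refine ⟨max 1 (Ω + C * 4), le_max_left _ _, fun f hf hper hf1 h hh hhπ => ?_⟩
  refine periodModular_div_le hp1 (le_max_left _ _) ?_
  set Φ : ℝ → ℝ≥0∞ := fun y => f y ^ p y * ω y with hΦdef
  have hΦ : AEMeasurable Φ volume := (hf.pow hp.aemeasurable).mul hω.weight.aemeasurable
  -- Where the average is at most 1, its power is at most 1 and $\omega$ suffices; elsewhere the
  -- single interval estimate applies, divided by the weight of the interval.
  have hpt : ∀ x, ballAverage h f x ^ p x * ω x ≤ ω x +
      C * ((ω x / ∫⁻ t in Ioo (x - h) (x + h), ω t) * ∫⁻ y in Ioo (x - h) (x + h), Φ y) := by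
    intro x
    have h2h : (x + h) - (x - h) = 2 * h := by ring
    have hW0 := (setLIntegral_Ioo_pos hω.weight (show x - h < x + h by linarith)).ne'
    have hW1 : ∫⁻ t in Ioo (x - h) (x + h), ω t ≠ ∞ :=
      ne_top_of_le_ne_top hfin (setLIntegral_Ioo_le_period hω.weight.periodic (by linarith))
    rcases le_total (ENNReal.ofReal (2 * h)) (∫⁻ y in Ioo (x - h) (x + h), f y) with hc | hc
    · refine le_add_left ?_
      have := hC f hf hper hf1 (x - h) (x + h) (by linarith) (by linarith)
        (by rwa [h2h]) x ⟨by linarith, by linarith⟩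
      rw [h2h, ← ENNReal.le_div_iff_mul_le (Or.inl hW0) (Or.inl hW1)] at this
      calc _ ≤ (C * ∫⁻ y in Ioo (x - h) (x + h), Φ y) / (∫⁻ t in Ioo (x - h) (x + h), ω t) *
            ω x := by gcongr; exact this
        _ = _ := by simp only [div_eq_mul_inv]; ring
    · refine le_add_right ?_
      have : ballAverage h f x ≤ 1 := ENNReal.div_le_of_le_mul (by rwa [one_mul])
      calc _ ≤ 1 * ω x := by
            gcongr
            exact ENNReal.rpow_le_one this (zero_le_one.trans (hp1 x))
        _ = ω x := one_mul _
  calc periodModular p ω (ballAverage h f)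
      ≤ ∫⁻ x in Icc (-π) π, (ω x + C * ((ω x / ∫⁻ t in Ioo (x - h) (x + h), ω t) *
          ∫⁻ y in Ioo (x - h) (x + h), Φ y)) := lintegral_mono hpt
    _ = (∫⁻ x in Icc (-π) π, ω x) + C * ∫⁻ x in Icc (-π) π,
          ((ω x / ∫⁻ t in Ioo (x - h) (x + h), ω t) * ∫⁻ y in Ioo (x - h) (x + h), Φ y) := by
        rw [lintegral_add_left' hω.weight.aemeasurable.restrict,
          lintegral_const_mul' _ _ ENNReal.coe_ne_top]
    _ ≤ Ω + C * (4 * 1) := by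
        refine add_le_add hΩ.ge (mul_le_mul_right ?_ _)
        exact (lintegral_weighted_ball_le hω.weight hΦ
          (periodic_rpow_mul hp.periodic hω.weight.periodic hper) hh hhπ).trans
            (mul_le_mul_right hf1 _)
    _ = ((Ω + C * 4 : ℝ≥0) : ℝ≥0∞) := by push_cast; ring
    _ ≤ _ := by exact_mod_cast le_max_right _ _

/-! ## Superpositions -/

theorem lintegral_rpow_le_lintegral_rpow {α : Type*} [MeasurableSpace α] {ν : Measure α}
    (hν : ν univ ≤ 1) {g : α → ℝ≥0∞} (hg : AEMeasurable g ν) {q : ℝ} (hq : 1 ≤ q) :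
    (∫⁻ u, g u ∂ν) ^ q ≤ ∫⁻ u, g u ^ q ∂ν := by
  have hq0 : 0 < q := by linarith
  have hq1 : q⁻¹ ≤ 1 := inv_le_one_of_one_le₀ hq
  have h := ENNReal.lintegral_mul_norm_pow_le (hg.pow_const q) (aemeasurable_const (b := 1))
    (inv_nonneg.mpr hq0.le) (sub_nonneg.mpr hq1) (add_sub_cancel _ _)
  simp only [ENNReal.one_rpow, mul_one, ENNReal.rpow_rpow_inv hq0.ne', lintegral_const,
    one_mul] at h
  rw [← ENNReal.le_rpow_inv_iff hq0]
  calc _ ≤ _ := h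
    _ ≤ (∫⁻ u, g u ^ q ∂ν) ^ q⁻¹ * 1 := by
      gcongr
      exact ENNReal.rpow_le_one hν (sub_nonneg.mpr hq1)
    _ = _ := mul_one _

/-- The unit modular ball is stable under superposition with respect to a subprobability
measure. -/
theorem periodModular_lintegral_le {α : Type*} [MeasurableSpace α] (hp : IsLogHolderExponent p)
    (hω : IsPeriodicWeight ω) {ν : Measure α} [SFinite ν] (hν : ν univ ≤ 1)
    {Φ : ℝ → α → ℝ≥0∞} (hΦ : Measurable (Function.uncurry Φ))
    (h : ∀ᵐ u ∂ν, periodModular p ω (fun x => Φ x u) ≤ 1) :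
    periodModular p ω (fun x => ∫⁻ u, Φ x u ∂ν) ≤ 1 := by
  have hm : AEMeasurable (Function.uncurry fun x u => Φ x u ^ p x * ω x)
      ((volume.restrict (Icc (-π) π)).prod ν) :=
    (hΦ.aemeasurable.pow (aemeasurable_fst hp.aemeasurable.restrict)).mul
      (aemeasurable_fst hω.aemeasurable.restrict)
  calc periodModular p ω (fun x => ∫⁻ u, Φ x u ∂ν)
      ≤ ∫⁻ x in Icc (-π) π, ∫⁻ u, Φ x u ^ p x * ω x ∂ν := by
        refine lintegral_mono fun x => ?_
        have hx : Measurable (Φ x) := hΦ.comp measurable_prodMk_left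
        simp only
        rw [lintegral_mul_const _ (hx.pow_const _)]
        gcongr
        exact lintegral_rpow_le_lintegral_rpow hν hx.aemeasurable (hp.one_le x)
    _ = ∫⁻ u, (∫⁻ x in Icc (-π) π, Φ x u ^ p x * ω x) ∂ν := lintegral_lintegral_swap hm
    _ ≤ ∫⁻ _, 1 ∂ν := lintegral_mono_ae h
    _ ≤ 1 := by rw [lintegral_const, one_mul]; exact hν

/-! ## Averages over long intervals -/

theorem ballAverage_div (h : ℝ) (f : ℝ → ℝ≥0∞) {a : ℝ≥0} (ha : 0 < a) (x : ℝ) :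
    ballAverage h (fun y => f y / a) x = ballAverage h f x / a := by
  have : (a : ℝ≥0∞)⁻¹ ≠ ∞ := ENNReal.inv_ne_top.mpr (by exact_mod_cast ha.ne')
  simp only [ballAverage, div_eq_mul_inv]
  rw [lintegral_mul_const' _ _ this]
  ring

/-- Averages are controlled only for radii up to $\pi$. A longer interval is covered by $r$ periods,
as $|u|\le\pi$, and then $\pi\le r|u|$ turns the factor $2r\pi$ into $2r^2|u|$. -/
theorem setLIntegral_ball_le_ballAverage {f : ℝ → ℝ≥0∞} (hf : Function.Periodic f (2 * π))
    {r : ℕ} {u : ℝ} (hr : 1 ≤ r) (hu : u ≠ 0) (huπ : |u| ≤ π) (x : ℝ) :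
    ∫⁻ y in Ioo (x - r * |u|) (x + r * |u|), f y ≤
      ENNReal.ofReal (2 * r ^ 2 * |u|) * ballAverage (min (r * |u|) π) f x := by
  have hpi := Real.pi_pos
  have hu0 : 0 < |u| := abs_pos.mpr hu
  have hr' : (1 : ℝ) ≤ r := by exact_mod_cast hr
  have hdiv : ∀ h : ℝ, 0 < h → ∫⁻ y in Ioo (x - h) (x + h), f y =
      ENNReal.ofReal (2 * h) * ballAverage h f x := fun h hh => by
    rw [ballAverage, ENNReal.mul_div_cancel (by simpa using hh) ENNReal.ofReal_ne_top]
  rcases le_total (r * |u|) π with h | h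
  · rw [min_eq_left h, hdiv _ (by positivity)]
    refine mul_le_mul_left (ENNReal.ofReal_le_ofReal ?_) _
    nlinarith [mul_le_mul_of_nonneg_right hr' (by positivity : 0 ≤ r * |u|)]
  · rw [min_eq_right h]
    calc _ ≤ ∫⁻ y in Ioc (x - r * π) (x - r * π + r * (2 * π)), f y := by
          refine lintegral_mono_set fun y hy => ⟨?_, ?_⟩
          · have : (r : ℝ) * |u| ≤ r * π := by gcongr
            linarith [hy.1]
          · have : (r : ℝ) * |u| ≤ r * π := by gcongr
            linarith [hy.2]
      _ = r * ∫⁻ y in Ioo (x - π) (x + π), f y := by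
          rw [setLIntegral_Ioc_eq_nsmul_period hf, setLIntegral_congr Ioo_ae_eq_Ioc,
            show x + π = x - π + 2 * π by ring, setLIntegral_Ioc_eq_period hf]
      _ = ENNReal.ofReal (2 * r * π) * ballAverage π f x := by
          rw [hdiv π hpi, ← mul_assoc, ← ENNReal.ofReal_natCast,
            ← ENNReal.ofReal_mul (by positivity)]
          congr 2; ring
      _ ≤ _ := by
          refine mul_le_mul_left (ENNReal.ofReal_le_ofReal ?_) _
          nlinarith [mul_le_mul_of_nonneg_left h (by positivity : (0 : ℝ) ≤ r)]

/-! ## Periodic functions with a derivative of order `s + 1` in the sense of primitives -/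

/-- `G` is the derivative of order `s + 1` of the periodic function `F`, in the sense that the
derivative of order `s` of `F` is continuous and is a primitive of `G`. -/
structure HasPeriodicDeriv (s : ℕ) (F G : ℝ → ℝ) : Prop where
  contDiff : ContDiff ℝ s F
  periodic : Function.Periodic F (2 * π)
  periodic_deriv : Function.Periodic G (2 * π)
  measurable_deriv : Measurable G
  intervalIntegrable : ∀ a b, IntervalIntegrable G volume a b
  integral_eq : ∀ a b, ∫ t in a..b, G t = iteratedDeriv s F b - iteratedDeriv s F a

theorem contDiff_fwdDiff {n : ℕ} {g : ℝ → ℝ} (hg : ContDiff ℝ n g) (u : ℝ) :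
    ContDiff ℝ n (fwdDiff u g) :=
  (hg.comp (contDiff_id.add contDiff_const)).sub hg

theorem iteratedDeriv_fwdDiff {n : ℕ} {g : ℝ → ℝ} (hg : ContDiff ℝ n g) (u x : ℝ) :
    iteratedDeriv n (fwdDiff u g) x = iteratedDeriv n g (x + u) - iteratedDeriv n g x := by
  have h1 : ContDiff ℝ n (fun y => g (y + u)) := hg.comp (contDiff_id.add contDiff_const)
  have h2 : fwdDiff u g = (fun y => g (y + u)) - g := rfl
  rw [h2, iteratedDeriv_sub h1.contDiffAt hg.contDiffAt, iteratedDeriv_comp_add_const]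

/-- Each difference costs a factor $|u|$ by the mean value inequality and widens the neighbourhood
by $|u|$; keeping it local is what later yields averages around $x$. -/
theorem abs_fwdDiff_iterate_le (n : ℕ) (u x B : ℝ) (g : ℝ → ℝ) (hg : ContDiff ℝ n g)
    (hB : ∀ t, |t - x| ≤ n * |u| → |iteratedDeriv n g t| ≤ B) :
    |(fwdDiff u)^[n] g x| ≤ |u| ^ n * B := by
  induction n generalizing g B with
  | zero => simpa using hB x (by simp)
  | succ n ih =>
    rw [Function.iterate_succ_apply, pow_succ, mul_assoc]
    have hgn : ContDiff ℝ n g := hg.of_le (by exact_mod_cast Nat.le_succ n)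
    refine ih (|u| * B) _ (contDiff_fwdDiff hgn u) fun t ht => ?_
    rw [iteratedDeriv_fwdDiff hgn, mul_comm]
    have hd : ∀ z, HasDerivAt (iteratedDeriv n g) (iteratedDeriv (n + 1) g z) z := fun z => by
      rw [iteratedDeriv_succ]
      exact ((hg.differentiable_iteratedDeriv n (by exact_mod_cast Nat.lt_succ_self n))
        z).hasDerivAt
    have := Convex.norm_image_sub_le_of_norm_hasDerivWithin_le (f := iteratedDeriv n g)
      (f' := iteratedDeriv (n + 1) g) (s := uIcc t (t + u)) (x := t) (y := t + u) (C := B)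
      (fun z _ => (hd z).hasDerivWithinAt) (fun z hz => ?_) (convex_uIcc _ _)
      left_mem_uIcc right_mem_uIcc
    · simpa [Real.norm_eq_abs] using this
    · refine hB z ?_
      have h1 : |z - t| ≤ |u| := by
        have := abs_sub_left_of_mem_uIcc hz
        simpa using this
      push_cast
      calc |z - x| = |(z - t) + (t - x)| := by congr 1; ring
        _ ≤ |z - t| + |t - x| := abs_add_le _ _
        _ ≤ (n + 1) * |u| := by linarith

/-- $G$ need not be bounded, so only $s$ of the $s+1$ differences become derivatives. The last is
the integral of $G$ over a segment between $t$ and $t+u$, within $(s+1)|u|$ of $x$. -/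
theorem HasPeriodicDeriv.enorm_fwdDiff_le {s : ℕ} {F G : ℝ → ℝ} (h : HasPeriodicDeriv s F G)
    (u x : ℝ) :
    ‖(fwdDiff u)^[s + 1] F x‖ₑ ≤ ENNReal.ofReal (|u| ^ s) *
      ∫⁻ y in Ioo (x - (s + 1 : ℕ) * |u|) (x + (s + 1 : ℕ) * |u|), ‖G y‖ₑ := by
  set I := ∫⁻ y in Ioo (x - (s + 1 : ℕ) * |u|) (x + (s + 1 : ℕ) * |u|), ‖G y‖ₑ with hI
  have hIfin : I ≠ ∞ := by
    have hle : x - (s + 1 : ℕ) * |u| ≤ x + (s + 1 : ℕ) * |u| := by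
      have : 0 ≤ ((s + 1 : ℕ) : ℝ) * |u| := by positivity
      linarith
    have := (intervalIntegrable_iff_integrableOn_Ioo_of_le hle).mp (h.intervalIntegrable _ _)
    exact this.2.ne
  have hB : ∀ t, |t - x| ≤ s * |u| → |iteratedDeriv s (fwdDiff u F) t| ≤ I.toReal := by
    intro t ht
    rw [iteratedDeriv_fwdDiff h.contDiff, ← h.integral_eq, ← Real.norm_eq_abs]
    have h1 : ‖∫ z in t..(t + u), G z‖ₑ ≤ I := by
      rw [intervalIntegral.intervalIntegral_eq_integral_uIoc]
      have h2 : ‖(if t ≤ t + u then (1 : ℝ) else -1) • ∫ z in uIoc t (t + u), G z‖ₑ =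
          ‖∫ z in uIoc t (t + u), G z‖ₑ := by
        split_ifs <;> simp
      rw [h2]
      refine (enorm_integral_le_lintegral_enorm _).trans ?_
      rw [hI, setLIntegral_congr Ioo_ae_eq_Icc]
      refine lintegral_mono_set fun z hz => ?_
      have h3 := abs_sub_left_of_mem_uIcc (uIoc_subset_uIcc hz)
      rw [add_sub_cancel_left] at h3
      have h4 : |z - x| ≤ (s + 1 : ℕ) * |u| := by
        push_cast
        calc |z - x| = |(z - t) + (t - x)| := by congr 1; ring
          _ ≤ |z - t| + |t - x| := abs_add_le _ _
          _ ≤ (s + 1) * |u| := by linarith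
      rw [abs_le] at h4
      exact ⟨by linarith [h4.1], by linarith [h4.2]⟩
    rw [← toReal_enorm]
    exact ENNReal.toReal_mono hIfin h1
  have := abs_fwdDiff_iterate_le s u x _ _ (contDiff_fwdDiff h.contDiff u) hB
  rw [Function.iterate_succ_apply, Real.enorm_eq_ofReal_abs]
  refine (ENNReal.ofReal_le_ofReal this).trans ?_
  rw [ENNReal.ofReal_mul (by positivity), ENNReal.ofReal_toReal hIfin]

/-! ## The Jackson kernel -/

theorem abs_sin_nat_mul_le (m : ℕ) (t : ℝ) : |Real.sin (m * t)| ≤ m * |Real.sin t| := by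
  induction m with
  | zero => simp
  | succ m ih =>
    have e : ((m + 1 : ℕ) : ℝ) * t = m * t + t := by push_cast; ring
    rw [e, Real.sin_add]
    calc _ ≤ |Real.sin (m * t) * Real.cos t| + |Real.cos (m * t) * Real.sin t| := abs_add_le _ _
      _ ≤ |Real.sin (m * t)| * 1 + 1 * |Real.sin t| := by
        rw [abs_mul, abs_mul]
        gcongr
        · exact Real.abs_cos_le_one _
        · exact Real.abs_cos_le_one _
      _ ≤ _ := by push_cast; linarith

theorem jacksonCore_nonneg (k n : ℕ) (u : ℝ) : 0 ≤ jacksonCore k n u := by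
  rw [jacksonCore, pow_mul]; positivity

theorem measurable_jacksonCore (k n : ℕ) : Measurable (jacksonCore k n) := by
  unfold jacksonCore; fun_prop

theorem jacksonCore_eq_abs (k n : ℕ) (u : ℝ) : jacksonCore k n u =
    (|Real.sin (((n / k + 1 : ℕ) : ℝ) * u / 2)| / |Real.sin (u / 2)|) ^ (2 * k) := by
  rw [jacksonCore, ← abs_div, (even_two_mul k).pow_abs]

theorem jacksonCore_le (k n : ℕ) (u : ℝ) : jacksonCore k n u ≤ ((n / k + 1 : ℕ) : ℝ) ^ (2 * k) := by
  rw [jacksonCore_eq_abs]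
  gcongr
  refine div_le_of_le_mul₀ (abs_nonneg _) (by positivity) ?_
  rw [mul_div_assoc]
  exact abs_sin_nat_mul_le _ _

theorem intervalIntegrable_jacksonCore_mul (k n : ℕ) {g : ℝ → ℝ} (hg : Continuous g) (a b : ℝ) :
    IntervalIntegrable (fun u => g u * jacksonCore k n u) volume a b := by
  refine ((hg.mul (continuous_const (y := ((n / k + 1 : ℕ) : ℝ) ^ (2 * k)))).intervalIntegrable
    a b).mono_fun (hg.measurable.mul (measurable_jacksonCore k n)).aestronglyMeasurable
    (Filter.Eventually.of_forall fun u => ?_)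
  simp only [Pi.mul_apply]
  rw [norm_mul, norm_mul, Real.norm_of_nonneg (jacksonCore_nonneg k n u),
    Real.norm_of_nonneg (by positivity : (0 : ℝ) ≤ ((n / k + 1 : ℕ) : ℝ) ^ (2 * k))]
  exact mul_le_mul_of_nonneg_left (jacksonCore_le k n u) (norm_nonneg _)

theorem abs_sin_half_ge {u : ℝ} (hu : |u| ≤ π) : |u| / π ≤ |Real.sin (u / 2)| := by
  have h := Real.mul_abs_le_abs_sin (x := u / 2) (by rw [abs_div, abs_two]; linarith)
  rw [abs_div, abs_two] at h
  calc |u| / π = 2 / π * (|u| / 2) := by ring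
    _ ≤ _ := h

/-- On $(0,\pi/m)$ one has $\sin(mu/2)\ge mu/\pi$ and $\sin(u/2)\le u/2$, so the quotient is at
least $2m/\pi$. -/
theorem integral_jacksonCore_ge (k n : ℕ) :
    π / (n / k + 1 : ℕ) * (2 * (n / k + 1 : ℕ) / π) ^ (2 * k) ≤
      ∫ u in (-π)..π, jacksonCore k n u := by
  set m : ℕ := n / k + 1 with hm
  have hm1 : (1 : ℝ) ≤ m := by exact_mod_cast Nat.le_add_left 1 _
  have hpi := Real.pi_pos
  have hint : ∀ a b, IntervalIntegrable (jacksonCore k n) volume a b := fun a b => by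
    simpa using intervalIntegrable_jacksonCore_mul k n (continuous_const (y := (1 : ℝ))) a b
  have hsub : π / m ≤ π := div_le_self hpi.le hm1
  have h0 : 0 < π / m := by positivity
  calc π / m * (2 * m / π) ^ (2 * k) = ∫ _ in (0)..(π / m), (2 * m / π) ^ (2 * k) := by
        rw [intervalIntegral.integral_const, sub_zero, smul_eq_mul]
    _ ≤ ∫ u in (0)..(π / m), jacksonCore k n u := by
        refine intervalIntegral.integral_mono_on_of_le_Ioo h0.le intervalIntegrable_const
          (hint _ _) fun u hu => ?_
        rw [jacksonCore_eq_abs, ← hm]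
        have hmu : m * u ≤ π := by
          have := hu.2.le
          rwa [le_div_iff₀ (by positivity), mul_comm] at this
        have hmu0 : 0 < m * u := mul_pos (by linarith) hu.1
        have h1 := abs_sin_half_ge (u := m * u) (by rw [abs_of_pos hmu0]; exact hmu)
        rw [abs_of_pos hmu0] at h1
        have h2 : |Real.sin (u / 2)| ≤ u / 2 := by
          have := Real.abs_sin_le_abs (x := u / 2)
          rwa [abs_of_pos (by linarith [hu.1] : 0 < u / 2)] at this
        have h3 : 0 < |Real.sin (u / 2)| := by
          have h4 := abs_sin_half_ge (u := u) (by
            rw [abs_of_pos hu.1]; linarith [hu.2])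
          rw [abs_of_pos hu.1] at h4
          exact lt_of_lt_of_le (div_pos hu.1 hpi) h4
        refine pow_le_pow_left₀ (by positivity) ?_ _
        rw [le_div_iff₀ h3]
        calc 2 * m / π * |Real.sin (u / 2)| ≤ 2 * m / π * (u / 2) := by gcongr
          _ = m * u / π := by ring
          _ ≤ _ := h1
    _ ≤ ∫ u in (-π)..π, jacksonCore k n u := by
        refine intervalIntegral.integral_mono_interval (by linarith) h0.le hsub
          (Filter.Eventually.of_forall fun u => jacksonCore_nonneg k n u) (hint _ _)

theorem integral_jacksonCore_pos (k n : ℕ) : 0 < ∫ u in (-π)..π, jacksonCore k n u :=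
  lt_of_lt_of_le (by have := Real.pi_pos; positivity) (integral_jacksonCore_ge k n)

/-- The core is at most $m^{2k}$ and at most $(\pi/|u|)^{2k}$; use the first for $m|u|\le1$ and the
second otherwise. The condition $r+2\le2k$ leaves two powers of decay, enough for an integrable
majorant. -/
theorem abs_pow_mul_jacksonCore_le {k r : ℕ} (hrk : r + 2 ≤ 2 * k) (n : ℕ) {u : ℝ}
    (hu : |u| ≤ π) :
    |u| ^ r * jacksonCore k n u ≤ 2 * π ^ (2 * k) * ((n / k + 1 : ℕ) : ℝ) ^ (2 * k - r) *
      (1 + (((n / k + 1 : ℕ) : ℝ) * u) ^ 2)⁻¹ := by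
  have hpi := Real.pi_pos
  have hpi1 : 1 ≤ π := by linarith [Real.pi_gt_three]
  obtain ⟨j, hj⟩ : ∃ j, 2 * k = r + 2 + j := ⟨_, (Nat.add_sub_cancel' hrk).symm⟩
  have hsub : 2 * k - r = j + 2 := by omega
  have hle := jacksonCore_le k n u
  have habs := jacksonCore_eq_abs k n u
  set m : ℕ := n / k + 1
  have hm1 : (1 : ℝ) ≤ m := by exact_mod_cast Nat.le_add_left 1 _
  have hm0 : (0 : ℝ) < m := by linarith
  have hsq : (m * u) ^ 2 = (m * |u|) ^ 2 := by rw [mul_pow, mul_pow, sq_abs]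
  rw [hsq, hsub, ← div_eq_mul_inv, le_div_iff₀ (by positivity)]
  rcases le_total (m * |u|) 1 with h | h
  · have h1 : |u| ^ r * m ^ r ≤ 1 := by
      rw [← mul_pow, mul_comm]; exact pow_le_one₀ (by positivity) h
    have h2 : 1 + (m * |u|) ^ 2 ≤ 2 := by
      have := pow_le_one₀ (by positivity) h (n := 2)
      linarith
    have h3 : (1 : ℝ) ≤ π ^ (2 * k) := one_le_pow₀ hpi1
    calc |u| ^ r * jacksonCore k n u * (1 + (m * |u|) ^ 2)
        ≤ |u| ^ r * m ^ (2 * k) * 2 := by gcongr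
      _ = (|u| ^ r * m ^ r) * m ^ (j + 2) * 2 := by rw [hj]; ring
      _ ≤ 1 * m ^ (j + 2) * 2 := by gcongr
      _ ≤ 2 * π ^ (2 * k) * m ^ (j + 2) := by nlinarith [pow_pos hm0 (j + 2)]
  · have hu0 : 0 < |u| := by
      by_contra hc
      have : |u| = 0 := le_antisymm (not_lt.mp hc) (abs_nonneg _)
      rw [this] at h; norm_num at h
    have h1 : jacksonCore k n u ≤ (π / |u|) ^ (2 * k) := by
      rw [habs]
      refine pow_le_pow_left₀ (by positivity) ?_ _
      have h4 := abs_sin_half_ge hu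
      have h5 : 0 < |Real.sin (u / 2)| := lt_of_lt_of_le (by positivity) h4
      rw [div_le_div_iff₀ h5 hu0]
      calc _ ≤ 1 * |u| := by gcongr; exact Real.abs_sin_le_one _
        _ = π * (|u| / π) := by field_simp
        _ ≤ _ := by gcongr
    have h2 : 1 + (m * |u|) ^ 2 ≤ 2 * (m * |u|) ^ (j + 2) := by
      have a1 := one_le_pow₀ h (n := 2)
      have a2 : (m * |u|) ^ 2 ≤ (m * |u|) ^ (j + 2) := pow_le_pow_right₀ h (by omega)
      linarith
    calc |u| ^ r * jacksonCore k n u * (1 + (m * |u|) ^ 2)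
        ≤ |u| ^ r * (π / |u|) ^ (2 * k) * (2 * (m * |u|) ^ (j + 2)) := by gcongr
      _ = 2 * π ^ (2 * k) * m ^ (j + 2) := by
        rw [div_pow, mul_pow]
        have : |u| ^ (2 * k) = |u| ^ r * |u| ^ (j + 2) := by rw [hj]; ring
        rw [this]
        field_simp

/-- By scaling, the moment of the core is $O(m^{2k-r-1})$ and the normalization is at least of order
$m^{2k-1}$. The quotient $m^{-r}$ becomes $n^{-r}$ because $n\le km$. -/
theorem exists_integral_abs_pow_mul_jacksonKernel_le {k r : ℕ} (hrk : r + 2 ≤ 2 * k) :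
    ∃ C : ℝ, 0 < C ∧ ∀ n : ℕ, 1 ≤ n →
      ∫ u in (-π)..π, |u| ^ r * jacksonKernel k n u ≤ C / n ^ r := by
  have hpi := Real.pi_pos
  have hk : 0 < k := by omega
  refine ⟨2 * π ^ (2 * k + 1) * (π / 2) ^ (2 * k) * k ^ r, by positivity, fun n hn => ?_⟩
  have hge := integral_jacksonCore_ge k n
  have hpt := fun u hu => abs_pow_mul_jacksonCore_le hrk n (u := u) hu
  have hnm : (n : ℝ) ≤ k * (n / k + 1 : ℕ) := by
    exact_mod_cast (Nat.lt_mul_div_succ n hk).le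
  set m : ℕ := n / k + 1
  have hm1 : (1 : ℝ) ≤ m := by exact_mod_cast Nat.le_add_left 1 _
  have hm0 : (0 : ℝ) < m := by linarith
  have hint : Integrable (fun u : ℝ => (1 + (m * u) ^ 2)⁻¹) :=
    integrable_inv_one_add_sq.comp_mul_left' hm0.ne'
  have hcore : ∫ u in (-π)..π, |u| ^ r * jacksonCore k n u ≤
      2 * π ^ (2 * k) * m ^ (2 * k - r) * (π / m) := by
    calc _ ≤ ∫ u in (-π)..π, 2 * π ^ (2 * k) * m ^ (2 * k - r) * (1 + (m * u) ^ 2)⁻¹ := by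
          refine intervalIntegral.integral_mono_on (by linarith)
            (intervalIntegrable_jacksonCore_mul k n (by fun_prop) _ _)
            (hint.const_mul _).intervalIntegrable fun u hu => hpt u (abs_le.mpr hu)
      _ = 2 * π ^ (2 * k) * m ^ (2 * k - r) * ∫ u in (-π)..π, (1 + (m * u) ^ 2)⁻¹ :=
          intervalIntegral.integral_const_mul _ _
      _ ≤ _ := by
          gcongr
          rw [intervalIntegral.integral_of_le (by linarith)]
          refine (setIntegral_le_integral hint
            (Filter.Eventually.of_forall fun u => by simp only [Pi.zero_apply]; positivity)).trans ?_
          rw [Measure.integral_comp_mul_left (fun x : ℝ => (1 + x ^ 2)⁻¹) (m : ℝ),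
            integral_univ_inv_one_add_sq, abs_of_pos (by positivity), smul_eq_mul, mul_comm,
            div_eq_mul_inv]
  have hpos := integral_jacksonCore_pos k n
  set N := ∫ u in (-π)..π, jacksonCore k n u
  have h1 : ∫ u in (-π)..π, |u| ^ r * jacksonKernel k n u =
      (∫ u in (-π)..π, |u| ^ r * jacksonCore k n u) / (1 / π * N) := by
    simp only [jacksonKernel, ← mul_div_assoc]
    exact intervalIntegral.integral_div _ _
  rw [h1]
  obtain ⟨j, hj⟩ : ∃ j, 2 * k = r + 2 + j := ⟨_, (Nat.add_sub_cancel' hrk).symm⟩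
  have hsub : 2 * k - r = j + 2 := by omega
  calc _ ≤ 2 * π ^ (2 * k) * m ^ (2 * k - r) * (π / m) /
        (1 / π * (π / m * (2 * m / π) ^ (2 * k))) := by gcongr
    _ = 2 * π ^ (2 * k + 1) * (π / 2) ^ (2 * k) / m ^ r := by
      have e : (m : ℝ) ^ (2 * k) = m ^ r * m ^ (2 * k - r) := by
        rw [← pow_add]; congr 1; omega
      rw [div_pow, div_pow, mul_pow, e]
      field_simp
      ring
    _ ≤ _ := by
      rw [div_le_div_iff₀ (by positivity) (by positivity)]
      have : (n : ℝ) ^ r ≤ k ^ r * m ^ r := by rw [← mul_pow]; gcongr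
      calc _ ≤ 2 * π ^ (2 * k + 1) * (π / 2) ^ (2 * k) * (k ^ r * m ^ r) := by gcongr
        _ = _ := by ring

/-! ## The direct estimate for the Jackson-Stechkin operator -/

theorem jacksonKernel_nonneg (k n : ℕ) (u : ℝ) : 0 ≤ jacksonKernel k n u :=
  div_nonneg (jacksonCore_nonneg k n u)
    (mul_nonneg (by have := Real.pi_pos; positivity) (integral_jacksonCore_pos k n).le)

theorem measurable_jacksonKernel (k n : ℕ) : Measurable (jacksonKernel k n) :=
  (measurable_jacksonCore k n).div_const _

theorem intervalIntegrable_mul_jacksonKernel (k n : ℕ) {g : ℝ → ℝ} (hg : Continuous g) (a b : ℝ) :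
    IntervalIntegrable (fun u => g u * jacksonKernel k n u) volume a b := by
  simp only [jacksonKernel, ← mul_div_assoc]
  exact (intervalIntegrable_jacksonCore_mul k n hg a b).div_const _

theorem integral_jacksonKernel (k n : ℕ) : 1 / π * ∫ u in (-π)..π, jacksonKernel k n u = 1 := by
  have h := integral_jacksonCore_pos k n
  have hpi := Real.pi_pos
  simp only [jacksonKernel]
  rw [intervalIntegral.integral_div]
  field_simp

theorem continuous_fwdDiff_iterate {F : ℝ → ℝ} (hF : Continuous F) (r : ℕ) (x : ℝ) :
    Continuous fun u => (fwdDiff u)^[r] F x := by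
  simp only [fwdDiff_iter_eq_sum_shift]
  fun_prop

theorem sub_jacksonStechkin {F : ℝ → ℝ} (hF : Continuous F) (k r n : ℕ) (x : ℝ) :
    F x - jacksonStechkin k r n F x =
      1 / π * ∫ u in (-π)..π, (-1) ^ r * (fwdDiff u)^[r] F x * jacksonKernel k n u := by
  have h1 := intervalIntegrable_mul_jacksonKernel k n (continuous_const (y := F x)) (-π) π
  have h2 := intervalIntegrable_mul_jacksonKernel k n
    ((continuous_const (y := F x)).add ((continuous_const (y := (-1 : ℝ) ^ (r + 1))).mul
      (continuous_fwdDiff_iterate hF r x))) (-π) π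
  simp only [Pi.add_apply, Pi.mul_apply] at h2
  have h3 : F x = 1 / π * ∫ u in (-π)..π, F x * jacksonKernel k n u := by
    rw [intervalIntegral.integral_const_mul, mul_left_comm, integral_jacksonKernel, mul_one]
  nth_rewrite 1 [h3]
  rw [jacksonStechkin, ← mul_sub, ← intervalIntegral.integral_sub h1 h2]
  congr 2
  ext u
  ring

theorem enorm_sub_jacksonStechkin_le {s : ℕ} {F G : ℝ → ℝ} (h : HasPeriodicDeriv s F G)
    (k n : ℕ) (x : ℝ) :
    ‖F x - jacksonStechkin k (s + 1) n F x‖ₑ ≤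
      ∫⁻ u in Ioc (-π) π, ENNReal.ofReal
        (2 * ((s + 1 : ℕ) : ℝ) ^ 2 * (|u| ^ (s + 1) * jacksonKernel k n u)) *
        ballAverage (min ((s + 1 : ℕ) * |u|) π) (fun y => ‖G y‖ₑ) x := by
  have hpi := Real.pi_pos
  have hper : Function.Periodic (fun y => ‖G y‖ₑ) (2 * π) := fun y => by
    simp only [h.periodic_deriv y]
  rw [sub_jacksonStechkin h.contDiff.continuous, enorm_mul,
    intervalIntegral.integral_of_le (by linarith)]
  have h1 : ‖1 / π‖ₑ ≤ 1 := by
    rw [Real.enorm_eq_ofReal (by positivity), ENNReal.ofReal_le_one]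
    exact div_le_one_of_le₀ (by linarith [Real.pi_gt_three]) hpi.le
  refine (mul_le_mul' h1 (enorm_integral_le_lintegral_enorm _)).trans ?_
  rw [one_mul]
  have hne : ∀ᵐ u ∂(volume.restrict (Ioc (-π) π)), u ≠ 0 :=
    ae_restrict_of_ae (Measure.ae_ne volume 0)
  refine lintegral_mono_ae ?_
  filter_upwards [hne, ae_restrict_mem measurableSet_Ioc] with u hu0 hu
  have huπ : |u| ≤ π := abs_le.mpr ⟨hu.1.le, hu.2⟩
  have hJ := jacksonKernel_nonneg k n u
  rw [enorm_mul, enorm_mul, enorm_pow, enorm_neg, enorm_one, one_pow, one_mul,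
    Real.enorm_eq_ofReal hJ]
  calc _ ≤ ENNReal.ofReal (|u| ^ s) * (ENNReal.ofReal (2 * ((s + 1 : ℕ) : ℝ) ^ 2 * |u|) *
          ballAverage (min ((s + 1 : ℕ) * |u|) π) (fun y => ‖G y‖ₑ) x) *
          ENNReal.ofReal (jacksonKernel k n u) := by
        gcongr
        refine (h.enorm_fwdDiff_le u x).trans ?_
        gcongr
        exact setLIntegral_ball_le_ballAverage hper (Nat.le_add_left 1 s) hu0 huπ x
    _ = ENNReal.ofReal (|u| ^ s) * ENNReal.ofReal (2 * ((s + 1 : ℕ) : ℝ) ^ 2 * |u|) *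
          ENNReal.ofReal (jacksonKernel k n u) *
          ballAverage (min ((s + 1 : ℕ) * |u|) π) (fun y => ‖G y‖ₑ) x := by ring
    _ = _ := by
        rw [← ENNReal.ofReal_mul (by positivity), ← ENNReal.ofReal_mul (by positivity)]
        congr 2
        ring

/-- The direct (Jackson type) estimate for the Jackson-Stechkin operator. -/
theorem exists_wNorm_sub_jacksonStechkin_le (hp : IsLogHolderExponent p)
    (hω : IsMuckenhoupt p ω) {s k : ℕ} (hsk : s + 3 ≤ 2 * k) :
    ∃ C : ℝ≥0, 0 < C ∧ ∀ n : ℕ, 1 ≤ n → ∀ F G : ℝ → ℝ, HasPeriodicDeriv s F G →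
      wNorm p ω (fun x => F x - jacksonStechkin k (s + 1) n F x) ≤
        C / (n : ℝ≥0∞) ^ (s + 1) * wNorm p ω G := by
  have hpi := Real.pi_pos
  obtain ⟨K, hK1, hK⟩ := exists_periodModular_ballAverage_le hp hω
  obtain ⟨B, hB, hBJ⟩ := exists_integral_abs_pow_mul_jacksonKernel_le
    (show s + 1 + 2 ≤ 2 * k by omega)
  set R : ℝ := ((s + 1 : ℕ) : ℝ) with hR
  have hR0 : 0 < R := by positivity
  set A : ℝ := 2 * R ^ 2 * B with hA
  have hA0 : 0 < A := by positivity
  have hK0 : 0 < K := one_pos.trans_le hK1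
  refine ⟨K * A.toNNReal, mul_pos hK0 (Real.toNNReal_pos.mpr hA0), fun n hn F G h => ?_⟩
  have hn0 : (0 : ℝ) < (n : ℝ) ^ (s + 1) := by positivity
  set c : ℝ := A / n ^ (s + 1) with hc
  have hc0 : 0 < c := by positivity
  have hcoe : ((K * A.toNNReal : ℝ≥0) : ℝ≥0∞) / (n : ℝ≥0∞) ^ (s + 1) =
      ((K * c.toNNReal : ℝ≥0) : ℝ≥0∞) := by
    rw [ENNReal.coe_mul, ENNReal.coe_mul, mul_div_assoc]
    congr 1
    change ENNReal.ofReal A / _ = ENNReal.ofReal c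
    rw [hc, ENNReal.ofReal_div_of_pos hn0, ENNReal.ofReal_pow (by positivity),
      ENNReal.ofReal_natCast]
  rw [hcoe]
  refine wNorm_le_mul hp.one_le (mul_pos hK0 (Real.toNNReal_pos.mpr hc0)) fun a ha hm => ?_
  -- the superposition measure
  set w : ℝ → ℝ := fun u => 2 * R ^ 2 * (|u| ^ (s + 1) * jacksonKernel k n u) with hw
  have hw0 : ∀ u, 0 ≤ w u := fun u => by
    have := jacksonKernel_nonneg k n u
    positivity
  have hwm : Measurable w := by
    have := measurable_jacksonKernel k n
    fun_prop
  -- Dividing by $c$, a bound for the total mass of the density `w`, makes this a subprobability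
  -- measure, as Jensen's inequality requires.
  set ν : Measure ℝ := (volume.restrict (Ioc (-π) π)).withDensity
    (fun u => ENNReal.ofReal (w u / c)) with hν
  have hνm : Measurable fun u => ENNReal.ofReal (w u / c) := (hwm.div_const c).ennreal_ofReal
  have hν1 : ν univ ≤ 1 := by
    rw [hν, withDensity_apply _ MeasurableSet.univ, Measure.restrict_univ]
    have hint : IntervalIntegrable w volume (-π) π :=
      (intervalIntegrable_mul_jacksonKernel k n (by fun_prop) _ _).const_mul _
    rw [← ofReal_integral_eq_lintegral_ofReal]
    · rw [ENNReal.ofReal_le_one, integral_div, div_le_one hc0,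
        ← intervalIntegral.integral_of_le (by linarith)]
      simp only [hw]
      rw [intervalIntegral.integral_const_mul]
      calc _ ≤ 2 * R ^ 2 * (B / n ^ (s + 1)) := by
            gcongr
            exact hBJ n hn
        _ = c := by rw [hc, hA]; ring
    · exact ((intervalIntegrable_iff_integrableOn_Ioc_of_le (by linarith)).mp hint).div_const _
    · exact Filter.Eventually.of_forall fun u => div_nonneg (hw0 u) hc0.le
  have hGm : Measurable fun y => ‖G y‖ₑ := h.measurable_deriv.enorm
  set g : ℝ → ℝ≥0∞ := fun y => ‖G y‖ₑ / a with hg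
  have hgm : Measurable g := hGm.div_const _
  have hgper : Function.Periodic g (2 * π) := fun y => by simp only [hg, h.periodic_deriv y]
  set Φ : ℝ → ℝ → ℝ≥0∞ := fun x u => ballAverage (min (R * |u|) π) g x / K with hΦ
  have hΦm : Measurable (Function.uncurry Φ) := by
    have e : Measurable fun z : ℝ × ℝ => min (R * |z.2|) π := by fun_prop
    refine Measurable.div_const (Measurable.div ?_ (e.const_mul 2).ennreal_ofReal) _
    exact (measurable_setLIntegral_ball hgm.aemeasurable).comp (measurable_fst.prodMk e)
  -- At $u=0$ the radius degenerates and the bound on averages is not available.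
  have hne : ∀ᵐ u ∂ν, u ≠ 0 := (withDensity_absolutelyContinuous _ _).ae_le
    (ae_restrict_of_ae (Measure.ae_ne volume 0))
  have hΦ1 : ∀ᵐ u ∂ν, periodModular p ω (fun x => Φ x u) ≤ 1 := by
    filter_upwards [hne] with u hu
    exact hK g hgm.aemeasurable hgper hm _
      (lt_min (mul_pos hR0 (abs_pos.mpr hu)) hpi) (min_le_right _ _)
  refine (periodModular_mono hp.one_le fun x => ?_).trans
    (periodModular_lintegral_le hp hω.weight hν1 hΦm hΦ1)
  have hΦx : Measurable (Φ x) := hΦm.comp measurable_prodMk_left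
  rw [hν, lintegral_withDensity_eq_lintegral_mul _ hνm hΦx]
  refine ENNReal.div_le_of_le_mul ((enorm_sub_jacksonStechkin_le h k n x).trans ?_)
  rw [← lintegral_mul_const' _ _ ENNReal.coe_ne_top]
  refine lintegral_mono fun u => ?_
  simp only [Pi.mul_apply, hΦ, hg]
  rw [ballAverage_div _ _ ha]
  have hK0' : (K : ℝ≥0∞) ≠ 0 := by exact_mod_cast hK0.ne'
  have ha' : (a : ℝ≥0∞) ≠ 0 := by exact_mod_cast ha.ne'
  have hcT : ((c.toNNReal : ℝ≥0) : ℝ≥0∞) = ENNReal.ofReal c := rfl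
  rw [ENNReal.ofReal_div_of_pos hc0, ENNReal.coe_mul, ENNReal.coe_mul, hcT]
  have hc0' : ENNReal.ofReal c ≠ 0 := by simpa using hc0
  generalize ballAverage (min (R * |u|) π) (fun y => ‖G y‖ₑ) x = b
  change ENNReal.ofReal (w u) * b ≤ _
  generalize ENNReal.ofReal (w u) = v
  have hcT' : ENNReal.ofReal c ≠ ∞ := ENNReal.ofReal_ne_top
  generalize ENNReal.ofReal c = d at hc0' hcT' ⊢
  simp only [div_eq_mul_inv]
  apply le_of_eq
  calc v * b = v * b * (d⁻¹ * d) * ((a : ℝ≥0∞)⁻¹ * a) * ((K : ℝ≥0∞)⁻¹ * K) := by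
        rw [ENNReal.inv_mul_cancel hc0' hcT', ENNReal.inv_mul_cancel ha' ENNReal.coe_ne_top,
          ENNReal.inv_mul_cancel hK0' ENNReal.coe_ne_top, mul_one, mul_one, mul_one]
    _ = _ := by ring

/-! ## Trigonometric polynomials -/

theorem zero_mem_trigPoly (n : ℕ) : (fun _ => 0) ∈ trigPoly n := ⟨0, fun x => by simp⟩

theorem add_mem_trigPoly {n : ℕ} {S T : ℝ → ℂ} (hS : S ∈ trigPoly n) (hT : T ∈ trigPoly n) :
    (fun x => S x + T x) ∈ trigPoly n := by
  obtain ⟨c, hc⟩ := hS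
  obtain ⟨d, hd⟩ := hT
  refine ⟨fun j => c j + d j, fun x => ?_⟩
  simp only [hc, hd, add_mul, Finset.sum_add_distrib]

theorem const_mul_mem_trigPoly {n : ℕ} {S : ℝ → ℂ} (hS : S ∈ trigPoly n) (a : ℂ) :
    (fun x => a * S x) ∈ trigPoly n := by
  obtain ⟨c, hc⟩ := hS
  refine ⟨fun j => a * c j, fun x => ?_⟩
  simp only [hc, Finset.mul_sum, mul_assoc]

theorem sum_mem_trigPoly {ι : Type*} {n : ℕ} (s : Finset ι) {S : ι → ℝ → ℂ}
    (hS : ∀ i ∈ s, S i ∈ trigPoly n) : (fun x => ∑ i ∈ s, S i x) ∈ trigPoly n := by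
  classical
  induction s using Finset.induction with
  | empty => simpa using zero_mem_trigPoly n
  | insert i s hi ih =>
    simp only [Finset.sum_insert hi]
    exact add_mem_trigPoly (hS i (Finset.mem_insert_self i s))
      (ih fun j hj => hS j (Finset.mem_insert_of_mem hj))

theorem exp_mem_trigPoly {n : ℕ} {l : ℤ} (hl : |l| ≤ n) :
    (fun x : ℝ => Complex.exp ((l : ℂ) * x * Complex.I)) ∈ trigPoly n := by
  refine ⟨fun j => if j = l then 1 else 0, fun x => ?_⟩
  have : l ∈ Finset.Icc (-(n : ℤ)) n := Finset.mem_Icc.mpr (abs_le.mp hl)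
  simp [ite_mul, this]

/-- The Dirichlet kernel identity in terms of $w=e^{it}$, cleared of denominators. -/
theorem sin_mul_exp_eq_geom_sum (m : ℕ) (t : ℂ) :
    Complex.sin (((m + 1 : ℕ) : ℂ) * t) * Complex.exp ((m : ℂ) * t * Complex.I) =
      Complex.sin t * ∑ j ∈ Finset.range (m + 1), Complex.exp (2 * t * Complex.I) ^ j := by
  have hw : Complex.exp (t * Complex.I) ≠ 0 := Complex.exp_ne_zero _
  set w := Complex.exp (t * Complex.I) with hwdef
  have h2 : Complex.exp (2 * t * Complex.I) = w ^ 2 := by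
    rw [hwdef, ← Complex.exp_nat_mul]; congr 1; push_cast; ring
  have hm : Complex.exp ((m : ℂ) * t * Complex.I) = w ^ m := by
    rw [hwdef, ← Complex.exp_nat_mul]; congr 1; ring
  have hm1 : Complex.exp (((m + 1 : ℕ) : ℂ) * t * Complex.I) = w ^ (m + 1) := by
    rw [hwdef, ← Complex.exp_nat_mul]; congr 1; ring
  have hg := mul_neg_geom_sum (w ^ 2) (m + 1)
  simp only [Complex.sin, neg_mul]
  rw [Complex.exp_neg, Complex.exp_neg, h2, hm, hm1, ← hwdef]
  have e : w⁻¹ - w = w⁻¹ * (1 - w ^ 2) := by field_simp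
  rw [e]
  calc _ = w⁻¹ * (1 - (w ^ 2) ^ (m + 1)) * Complex.I / 2 := by
        field_simp
        ring
    _ = _ := by rw [← hg]; ring

/-- The core is $e^{-idu}P(e^{iu})$ with $P=(1+z+\dots+z^{\lfloor n/k\rfloor})^{2k}$ and $d=k\lfloor
n/k\rfloor\le n$. Zeros of $\sin(u/2)$ are excluded since division by zero gives the quotient the
value 0 there. -/
theorem exists_jacksonCore_eq_sum (k n : ℕ) : ∃ (d : ℕ) (b : ℕ → ℂ), d ≤ n ∧
    ∀ u : ℝ, Real.sin (u / 2) ≠ 0 → ((jacksonCore k n u : ℝ) : ℂ) =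
      ∑ i ∈ Finset.range (2 * d + 1), b i *
        Complex.exp ((((i : ℤ) - (d : ℤ) : ℤ) : ℂ) * u * Complex.I) := by
  set P : Polynomial ℂ :=
    (∑ j ∈ Finset.range (n / k + 1), Polynomial.X ^ j) ^ (2 * k) with hP
  have hdeg : P.natDegree < 2 * (k * (n / k)) + 1 := by
    have h1 : (∑ j ∈ Finset.range (n / k + 1), (Polynomial.X : Polynomial ℂ) ^ j).natDegree ≤
        n / k := by
      refine Polynomial.natDegree_sum_le_of_forall_le _ _ fun j hj => ?_
      rw [Polynomial.natDegree_X_pow]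
      exact Nat.lt_succ_iff.mp (Finset.mem_range.mp hj)
    have h2 := Polynomial.natDegree_pow_le_of_le (2 * k) h1
    have h3 : 2 * k * (n / k) = 2 * (k * (n / k)) := by ring
    rw [hP]
    omega
  refine ⟨k * (n / k), P.coeff, Nat.mul_div_le n k, fun u hu => ?_⟩
  set m := n / k
  set d := k * m with hd
  set z := Complex.exp (u * Complex.I) with hz
  have hs : Complex.sin ((u : ℂ) / 2) ≠ 0 := by
    have : ((Real.sin (u / 2) : ℝ) : ℂ) ≠ 0 := by exact_mod_cast hu
    simpa using this
  have hgeom := sin_mul_exp_eq_geom_sum m ((u : ℂ) / 2)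
  rw [show 2 * ((u : ℂ) / 2) * Complex.I = u * Complex.I by ring, ← hz] at hgeom
  have hq : Complex.sin (((m + 1 : ℕ) : ℂ) * u / 2) / Complex.sin ((u : ℂ) / 2) =
      Complex.exp (-((m : ℂ) * ((u : ℂ) / 2) * Complex.I)) *
        ∑ j ∈ Finset.range (m + 1), z ^ j := by
    rw [div_eq_iff hs, Complex.exp_neg, mul_div_assoc]
    have he := Complex.exp_ne_zero ((m : ℂ) * ((u : ℂ) / 2) * Complex.I)
    field_simp at hgeom ⊢
    linear_combination hgeom
  have hcore : ((jacksonCore k n u : ℝ) : ℂ) =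
      Complex.exp (-((d : ℂ) * u * Complex.I)) * P.eval z := by
    rw [jacksonCore]
    push_cast
    have hq' := hq
    push_cast at hq'
    rw [hq', mul_pow, ← Complex.exp_nat_mul, hP, Polynomial.eval_pow, Polynomial.eval_finsetSum]
    simp only [Polynomial.eval_pow, Polynomial.eval_X]
    congr 2
    rw [hd]; push_cast; ring
  rw [hcore, Polynomial.eval_eq_sum_range' hdeg, Finset.mul_sum]
  refine Finset.sum_congr rfl fun i _ => ?_
  rw [hz, ← Complex.exp_nat_mul, mul_left_comm, ← Complex.exp_add]
  congr 2
  push_cast; ring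

/-- The shift $u\mapsto u-x/j$ shows that the integral is $c\,e^{-ilx/j}$. Invariance under the
shift by $2\pi/j$ forces $c=0$ unless $j\mid l$, and then $-l/j$ is an integer frequency with
$|l/j|\le|l|\le n$. -/
theorem integral_comp_mul_exp_mem_trigPoly {F : ℝ → ℝ} (hper : Function.Periodic F (2 * π))
    {j : ℕ} (hj : 1 ≤ j) {l : ℤ} {n : ℕ} (hl : |l| ≤ n) :
    (fun x : ℝ => ∫ u in (-π)..π, (F (x + j * u) : ℂ) * Complex.exp ((l : ℂ) * u * Complex.I)) ∈
      trigPoly n := by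
  have hj0 : (j : ℝ) ≠ 0 := by positivity
  have hj0' : (j : ℂ) ≠ 0 := by exact_mod_cast hj0
  set φ : ℝ → ℝ → ℂ := fun x u => (F (x + j * u) : ℂ) * Complex.exp ((l : ℂ) * u * Complex.I)
    with hφ
  have hφper : ∀ x, Function.Periodic (φ x) (2 * π) := fun x u => by
    have e1 : F (x + j * (u + 2 * π)) = F (x + j * u) := by
      rw [← hper.nat_mul j (x + j * u)]; congr 1; ring
    have e2 : Complex.exp ((l : ℂ) * (u + 2 * π : ℝ) * Complex.I) =
        Complex.exp ((l : ℂ) * u * Complex.I) := by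
      rw [Complex.exp_eq_exp_iff_exists_int]
      exact ⟨l, by push_cast; ring⟩
    simp only [hφ, e1, e2]
  have hshift : ∀ x t, ∫ u in (-π)..π, φ x (u + t) = ∫ u in (-π)..π, φ x u := fun x t => by
    rw [intervalIntegral.integral_comp_add_right]
    have := (hφper x).intervalIntegral_add_eq (-π + t) (-π)
    rw [show -π + t + 2 * π = π + t by ring, show -π + 2 * π = π by ring] at this
    exact this
  set c := ∫ u in (-π)..π, φ 0 u with hc
  have hx : ∀ x, ∫ u in (-π)..π, φ x u =
      c * Complex.exp (-((l : ℂ) * (x / j) * Complex.I)) := fun x => by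
    rw [← hshift x (-(x / j)), hc, ← intervalIntegral.integral_mul_const]
    congr 1
    ext u
    have e1 : x + j * (u + -(x / j)) = 0 + j * u := by field_simp; ring
    simp only [hφ, e1]
    rw [mul_assoc (F (0 + j * u) : ℂ), ← Complex.exp_add]
    congr 2
    push_cast; ring
  by_cases hc0 : c = 0
  · have : (fun x : ℝ => ∫ u in (-π)..π, φ x u) = fun _ => 0 := by
      ext x; rw [hx, hc0, zero_mul]
    change (fun x : ℝ => ∫ u in (-π)..π, φ x u) ∈ _
    rw [this]
    exact zero_mem_trigPoly n
  · have h1 : c = Complex.exp ((l : ℂ) * (2 * π / j) * Complex.I) * c := by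
      nth_rewrite 1 [hc]
      rw [← hshift 0 (2 * π / j), hc, ← intervalIntegral.integral_const_mul]
      congr 1
      ext u
      simp only [hφ]
      have e1 : F (0 + j * (u + 2 * π / j)) = F (0 + j * u) := by
        rw [← hper (0 + j * u)]; congr 1; field_simp; ring
      rw [e1, mul_left_comm, ← Complex.exp_add]
      congr 2
      push_cast; ring
    have h2 : Complex.exp ((l : ℂ) * (2 * π / j) * Complex.I) = 1 :=
      (mul_eq_right₀ hc0).mp h1.symm
    obtain ⟨q, hq⟩ := Complex.exp_eq_one_iff.mp h2
    have hlq : (l : ℂ) = q * j := by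
      have hpi : (π : ℂ) ≠ 0 := by exact_mod_cast Real.pi_ne_zero
      field_simp at hq
      linear_combination hq
    have hlq' : l = q * j := by exact_mod_cast hlq
    have hq' : |-q| ≤ n := by
      rw [abs_neg]
      refine le_trans ?_ hl
      rw [hlq', abs_mul]
      refine le_mul_of_one_le_right (abs_nonneg _) ?_
      rw [Nat.abs_cast]; exact_mod_cast hj
    have h3 : (fun x : ℝ => ∫ u in (-π)..π, φ x u) =
        fun x : ℝ => c * Complex.exp (((-q : ℤ) : ℂ) * x * Complex.I) := by
      ext x
      rw [hx, hlq]
      congr 2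
      push_cast
      field_simp
    change (fun x : ℝ => ∫ u in (-π)..π, φ x u) ∈ _
    rw [h3]
    exact const_mul_mem_trigPoly (exp_mem_trigPoly hq') c

theorem ae_sin_half_ne_zero : ∀ᵐ u : ℝ ∂volume.restrict (Ioc (-π) π), Real.sin (u / 2) ≠ 0 := by
  have hne : ∀ᵐ u ∂(volume.restrict (Ioc (-π) π)), u ≠ 0 :=
    ae_restrict_of_ae (Measure.ae_ne volume 0)
  have hpi := Real.pi_pos
  filter_upwards [hne, ae_restrict_mem measurableSet_Ioc] with u hu hI
  rw [Ne, Real.sin_eq_zero_iff_of_lt_of_lt (by linarith [hI.1]) (by linarith [hI.2])]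
  simpa using hu

theorem integral_comp_mul_jacksonCore_mem_trigPoly {F : ℝ → ℝ} (hF : Continuous F)
    (hper : Function.Periodic F (2 * π)) {j : ℕ} (hj : 1 ≤ j) (k n : ℕ) :
    (fun x : ℝ => ((∫ u in (-π)..π, F (x + j * u) * jacksonCore k n u : ℝ) : ℂ)) ∈
      trigPoly n := by
  have hpi := Real.pi_pos
  obtain ⟨d, b, hd, hb⟩ := exists_jacksonCore_eq_sum k n
  have h : (fun x : ℝ => ((∫ u in (-π)..π, F (x + j * u) * jacksonCore k n u : ℝ) : ℂ)) =
      fun x : ℝ => ∑ i ∈ Finset.range (2 * d + 1), b i * ∫ u in (-π)..π,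
        (F (x + j * u) : ℂ) * Complex.exp ((((i : ℤ) - (d : ℤ) : ℤ) : ℂ) * u * Complex.I) := by
    ext x
    simp only [← intervalIntegral.integral_const_mul]
    rw [← intervalIntegral.integral_finsetSum, ← intervalIntegral.integral_ofReal]
    · rw [intervalIntegral.integral_of_le (by linarith), intervalIntegral.integral_of_le
        (by linarith)]
      refine integral_congr_ae ?_
      filter_upwards [ae_sin_half_ne_zero] with u hu
      push_cast [hb u hu]
      rw [Finset.mul_sum]
      refine Finset.sum_congr rfl fun i _ => ?_
      ring
    · intro i _
      apply Continuous.intervalIntegrable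
      fun_prop
  rw [h]
  refine sum_mem_trigPoly _ fun i hi => const_mul_mem_trigPoly
    (integral_comp_mul_exp_mem_trigPoly hper hj ?_) _
  have := Finset.mem_range.mp hi
  rw [abs_le]; constructor <;> omega

/-- Expanding $\tilde\Delta_u^r$, the unshifted term has sign $(-1)^{r+1}(-1)^r=-1$ and cancels
$F(x)$. Only the translates $F(x+ju)$ with $j\ge1$ remain. -/
theorem jacksonStechkin_mem_trigPoly {F : ℝ → ℝ} (hF : Continuous F)
    (hper : Function.Periodic F (2 * π)) (k r n : ℕ) :
    (fun x : ℝ => ((jacksonStechkin k r n F x : ℝ) : ℂ)) ∈ trigPoly n := by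
  set N : ℝ := 1 / π * ∫ t in (-π)..π, jacksonCore k n t with hN
  set a : ℕ → ℝ := fun j => (-1) ^ (r + 1) * ((-1) ^ (r - (j + 1)) * (r.choose (j + 1) : ℝ))
    with ha
  have h : ∀ x, jacksonStechkin k r n F x = ∑ j ∈ Finset.range r, (1 / π * (a j / N)) *
      ∫ u in (-π)..π, F (x + (j + 1 : ℕ) * u) * jacksonCore k n u := by
    intro x
    simp only [mul_assoc (1 / π), ← Finset.mul_sum, ← intervalIntegral.integral_const_mul (_ / N)]
    rw [jacksonStechkin, ← intervalIntegral.integral_finsetSum]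
    · congr 2
      ext u
      rw [fwdDiff_iter_eq_sum_shift, Finset.sum_range_succ']
      simp only [zero_smul, add_zero, Nat.sub_zero, Nat.choose_zero_right, Nat.cast_one, mul_one,
        zsmul_eq_mul, nsmul_eq_mul, jacksonKernel, ← hN]
      push_cast
      have e : (-1 : ℝ) ^ (r + 1) * ((-1) ^ r * F x) = -F x := by
        rw [← mul_assoc, ← pow_add, show r + 1 + r = 2 * r + 1 by ring, pow_succ, pow_mul]
        simp
      rw [mul_add, e, add_comm (F x), neg_add_cancel_right, Finset.mul_sum, Finset.sum_mul]
      refine Finset.sum_congr rfl fun j _ => ?_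
      simp only [ha]
      ring
    · intro j _
      exact (intervalIntegrable_jacksonCore_mul k n (by fun_prop) _ _).const_mul _
  have h' : (fun x : ℝ => ((jacksonStechkin k r n F x : ℝ) : ℂ)) = fun x : ℝ =>
      ∑ j ∈ Finset.range r, (((1 / π * (a j / N) : ℝ)) : ℂ) *
      ((∫ u in (-π)..π, F (x + (j + 1 : ℕ) * u) * jacksonCore k n u : ℝ) : ℂ) := by
    ext x
    rw [h x, Complex.ofReal_sum]
    simp only [Complex.ofReal_mul]
  rw [h']
  exact sum_mem_trigPoly _ fun j _ => const_mul_mem_trigPoly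
    (integral_comp_mul_jacksonCore_mem_trigPoly hF hper (Nat.le_add_left 1 j) k n) _

/-! ## Sobolev functions and their derivatives -/

theorem periodic_iteratedDeriv {f : ℝ → ℝ} {c : ℝ} (hf : Function.Periodic f c) (n : ℕ) :
    Function.Periodic (iteratedDeriv n f) c := fun x => by
  have h : (fun y => f (y + c)) = f := funext hf
  have := congr_fun (iteratedDeriv_comp_add_const n f c) x
  rw [h] at this
  exact this.symm

theorem iteratedDeriv_iteratedDeriv_add (m n : ℕ) (f : ℝ → ℝ) :
    iteratedDeriv m (iteratedDeriv n f) = iteratedDeriv (n + m) f := by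
  rw [iteratedDeriv_eq_iterate, iteratedDeriv_eq_iterate, iteratedDeriv_eq_iterate, add_comm,
    Function.iterate_add_apply]

/-- Absolute continuity is given on one period only. There the difference `P` between the primitive
and $H$ is constant; it is periodic because $H'$ has integral zero over a period, hence constant on
the line. -/
theorem integral_deriv_eq_sub_of_periodic {H : ℝ → ℝ} (hH : Function.Periodic H (2 * π))
    (hac : AbsolutelyContinuousOnInterval H (-π) π)
    (hint : ∀ a b, IntervalIntegrable (deriv H) volume a b) (a b : ℝ) :
    ∫ t in a..b, deriv H t = H b - H a := by
  have hpi := Real.pi_pos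
  have hper : Function.Periodic (deriv H) (2 * π) := by
    simpa [iteratedDeriv_one] using periodic_iteratedDeriv hH 1
  have h0 : ∫ t in (-π)..π, deriv H t = 0 := by
    rw [hac.integral_deriv_eq_sub, sub_eq_zero, ← hH (-π)]
    congr 1; ring
  set P : ℝ → ℝ := fun x => (∫ t in (-π)..x, deriv H t) - H x with hP
  have hPper : Function.Periodic P (2 * π) := fun x => by
    have h1 := intervalIntegral.integral_add_adjacent_intervals (hint (-π) x)
      (hint x (x + 2 * π))
    have h2 := hper.intervalIntegral_add_eq x (-π)
    rw [show -π + 2 * π = π by ring, h0] at h2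
    simp only [hP, hH x]
    rw [← h1, h2, add_zero]
  have hPc : ∀ x, P x = -H (-π) := fun x => by
    obtain ⟨y, hy, hxy⟩ := hPper.exists_mem_Ico Real.two_pi_pos x (-π)
    rw [hxy]
    have hy' : y ≤ π := by linarith [hy.2]
    have := (hac.mono (c := -π) (d := y) (by
      rw [uIcc_of_le hy.1, uIcc_of_le (by linarith)]
      exact Icc_subset_Icc_right hy')).integral_deriv_eq_sub
    simp only [hP, this]
    ring
  have h1 := intervalIntegral.integral_interval_sub_left (hint (-π) b) (hint (-π) a)
  have ha := hPc a
  have hb := hPc b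
  simp only [hP] at ha hb
  linarith

theorem MemSobolev.hasPeriodicDeriv {α s : ℕ} {f : ℝ → ℝ} (h : MemSobolev p ω (α + (s + 1)) f) :
    HasPeriodicDeriv s (iteratedDeriv α f) (iteratedDeriv (α + (s + 1)) f) := by
  have hpi := Real.pi_pos
  have h1 : 1 ≤ α + (s + 1) := by omega
  have hsub : α + (s + 1) - 1 = α + s := by omega
  have hc := h.contDiff h1
  have hac := h.absCont h1
  rw [hsub] at hc hac
  have hG : iteratedDeriv (α + (s + 1)) f = deriv (iteratedDeriv (α + s) f) := by
    rw [← add_assoc, iteratedDeriv_succ]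
  have hint : ∀ a b, IntervalIntegrable (iteratedDeriv (α + (s + 1)) f) volume a b := by
    have h2 := hac.intervalIntegrable_deriv
    rw [← hG] at h2
    refine fun a b => (periodic_iteratedDeriv h.mem.periodic _).intervalIntegrable
      Real.two_pi_pos.ne' (t := -π) ?_ a b
    rwa [show -π + 2 * π = π by ring]
  refine ⟨?_, periodic_iteratedDeriv h.mem.periodic _, periodic_iteratedDeriv h.mem.periodic _,
    ?_, hint, ?_⟩
  · rw [iteratedDeriv_eq_iterate]
    refine ContDiff.iterate_deriv' s α ?_
    rw [add_comm]
    exact_mod_cast hc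
  · rw [hG]; exact measurable_deriv _
  · rw [iteratedDeriv_iteratedDeriv_add, hG]
    rw [hG] at hint
    exact integral_deriv_eq_sub_of_periodic (periodic_iteratedDeriv h.mem.periodic _) hac hint

theorem HasPeriodicDeriv.sub {s : ℕ} {F G F' G' : ℝ → ℝ} (h : HasPeriodicDeriv s F G)
    (h' : HasPeriodicDeriv s F' G') :
    HasPeriodicDeriv s (fun x => F x - F' x) (fun x => G x - G' x) where
  contDiff := h.contDiff.sub h'.contDiff
  periodic := h.periodic.sub h'.periodic
  periodic_deriv := h.periodic_deriv.sub h'.periodic_deriv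
  measurable_deriv := h.measurable_deriv.sub h'.measurable_deriv
  intervalIntegrable a b := (h.intervalIntegrable a b).sub (h'.intervalIntegrable a b)
  integral_eq a b := by
    have e : ∀ x, iteratedDeriv s (fun x => F x - F' x) x =
        iteratedDeriv s F x - iteratedDeriv s F' x := fun x =>
      iteratedDeriv_sub h.contDiff.contDiffAt h'.contDiff.contDiffAt
    rw [intervalIntegral.integral_sub (h.intervalIntegrable a b) (h'.intervalIntegrable a b),
      h.integral_eq, h'.integral_eq, e, e]
    ring

theorem HasPeriodicDeriv.integral_period {s : ℕ} {F G : ℝ → ℝ} (h : HasPeriodicDeriv s F G) :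
    ∫ t in (-π)..π, G t = 0 := by
  rw [h.integral_eq, sub_eq_zero, ← periodic_iteratedDeriv h.periodic s (-π)]
  congr 1; ring

/-! ## Real trigonometric sums and their derivatives -/

/-- The derivative of order `q` of the real part of `∑ a j * exp (i j x)`. -/
def reTrigSum (n : ℕ) (a : ℤ → ℂ) (q : ℕ) (x : ℝ) : ℝ :=
  (∑ j ∈ Finset.Icc (-(n : ℤ)) n,
    a j * ((j : ℂ) * Complex.I) ^ q * Complex.exp ((j : ℂ) * x * Complex.I)).re

theorem contDiff_reTrigSum (n : ℕ) (a : ℤ → ℂ) (q : ℕ) (m : WithTop ℕ∞) :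
    ContDiff ℝ m (reTrigSum n a q) := by
  refine Complex.reCLM.contDiff.comp (ContDiff.sum fun j _ => contDiff_const.mul ?_)
  exact ((contDiff_const.mul Complex.ofRealCLM.contDiff).mul contDiff_const).cexp

theorem hasDerivAt_reTrigSum (n : ℕ) (a : ℤ → ℂ) (q : ℕ) (x : ℝ) :
    HasDerivAt (reTrigSum n a q) (reTrigSum n a (q + 1) x) x := by
  have hj : ∀ j ∈ Finset.Icc (-(n : ℤ)) n, HasDerivAt (fun x : ℝ => a j *
      ((j : ℂ) * Complex.I) ^ q * Complex.exp ((j : ℂ) * x * Complex.I))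
      (a j * ((j : ℂ) * Complex.I) ^ (q + 1) * Complex.exp ((j : ℂ) * x * Complex.I)) x := by
    intro j _
    have h1 : HasDerivAt (fun x : ℝ => (j : ℂ) * x * Complex.I) ((j : ℂ) * 1 * Complex.I) x :=
      (((Complex.ofRealCLM.hasDerivAt (x := x)).const_mul (j : ℂ)).mul_const Complex.I)
    exact (h1.cexp.const_mul (a j * ((j : ℂ) * Complex.I) ^ q)).congr_deriv (by ring)
  exact (Complex.reCLM.hasFDerivAt.comp_hasDerivAt x (HasDerivAt.fun_sum hj))

theorem iteratedDeriv_reTrigSum (n : ℕ) (a : ℤ → ℂ) (q : ℕ) :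
    iteratedDeriv q (reTrigSum n a 0) = reTrigSum n a q := by
  induction q with
  | zero => simp
  | succ q ih =>
    rw [iteratedDeriv_succ, ih]
    ext x
    exact (hasDerivAt_reTrigSum n a q x).deriv

theorem periodic_exp_int (j : ℤ) :
    Function.Periodic (fun x : ℝ => Complex.exp ((j : ℂ) * x * Complex.I)) (2 * π) := fun x => by
  simp only
  rw [Complex.exp_eq_exp_iff_exists_int]
  exact ⟨j, by push_cast; ring⟩

theorem periodic_reTrigSum (n : ℕ) (a : ℤ → ℂ) (q : ℕ) :
    Function.Periodic (reTrigSum n a q) (2 * π) := fun x => by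
  simp only [reTrigSum]
  congr 1
  refine Finset.sum_congr rfl fun j _ => ?_
  congr 1
  exact periodic_exp_int j x

theorem hasPeriodicDeriv_reTrigSum (n : ℕ) (a : ℤ → ℂ) (s : ℕ) :
    HasPeriodicDeriv s (reTrigSum n a 0) (reTrigSum n a (s + 1)) where
  contDiff := contDiff_reTrigSum n a 0 s
  periodic := periodic_reTrigSum n a 0
  periodic_deriv := periodic_reTrigSum n a (s + 1)
  measurable_deriv := (contDiff_reTrigSum n a (s + 1) 0).continuous.measurable
  intervalIntegrable _ _ := (contDiff_reTrigSum n a (s + 1) 0).continuous.intervalIntegrable _ _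
  integral_eq a' b' := by
    rw [iteratedDeriv_reTrigSum]
    exact intervalIntegral.integral_eq_sub_of_hasDerivAt
      (fun x _ => hasDerivAt_reTrigSum n a s x)
      ((contDiff_reTrigSum n a (s + 1) 0).continuous.intervalIntegrable _ _)

theorem reTrigSum_mem_trigPoly (n : ℕ) (a : ℤ → ℂ) :
    (fun x : ℝ => ((reTrigSum n a 0 x : ℝ) : ℂ)) ∈ trigPoly n := by
  have h : (fun x : ℝ => ((reTrigSum n a 0 x : ℝ) : ℂ)) = fun x : ℝ =>
      ∑ j ∈ Finset.Icc (-(n : ℤ)) n, (a j / 2 * Complex.exp ((j : ℂ) * x * Complex.I) +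
        (starRingEnd ℂ (a j)) / 2 * Complex.exp (((-j : ℤ) : ℂ) * x * Complex.I)) := by
    ext x
    rw [reTrigSum, Complex.re_eq_add_conj, map_sum, ← Finset.sum_add_distrib, Finset.sum_div]
    refine Finset.sum_congr rfl fun j _ => ?_
    simp only [pow_zero, mul_one, map_mul, ← Complex.exp_conj, Complex.conj_I,
      Complex.conj_ofReal, map_intCast]
    push_cast
    rw [show (j : ℂ) * x * -Complex.I = -j * x * Complex.I by ring]
    ring
  rw [h]
  refine sum_mem_trigPoly _ fun j hj => ?_
  have hj' : |j| ≤ n := abs_le.mpr (Finset.mem_Icc.mp hj)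
  exact add_mem_trigPoly (const_mul_mem_trigPoly (exp_mem_trigPoly hj') _)
    (const_mul_mem_trigPoly (exp_mem_trigPoly (by rwa [abs_neg])) _)

/-- Every trigonometric polynomial has, up to a constant, a real primitive of order `s + 1`. -/
theorem exists_reTrigSum_eq {n : ℕ} {T : ℝ → ℂ} (hT : T ∈ trigPoly n) (s : ℕ) :
    ∃ (a : ℤ → ℂ) (c : ℝ), ∀ x, reTrigSum n a (s + 1) x = (T x).re - c := by
  obtain ⟨b, hb⟩ := hT
  -- Divide by $(ij)^{s+1}$. The zero frequency has no periodic primitive, so its real part is split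
  -- off as $c$.
  refine ⟨fun j => if j = 0 then 0 else b j / ((j : ℂ) * Complex.I) ^ (s + 1), (b 0).re,
    fun x => ?_⟩
  rw [hb, reTrigSum, ← Complex.sub_re]
  congr 1
  have h0 : (0 : ℤ) ∈ Finset.Icc (-(n : ℤ)) n := by simp
  rw [← Finset.add_sum_erase _ _ h0, ← Finset.add_sum_erase _ _ h0]
  simp only [if_true, zero_mul, zero_add, Int.cast_zero, Complex.exp_zero, mul_one,
    add_sub_cancel_left]
  refine Finset.sum_congr rfl fun j hj => ?_
  have hj0 : j ≠ 0 := (Finset.mem_erase.mp hj).1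
  have hj0' : ((j : ℂ) * Complex.I) ≠ 0 :=
    mul_ne_zero (by exact_mod_cast hj0) Complex.I_ne_zero
  rw [if_neg hj0, div_mul_cancel₀ _ (pow_ne_zero _ hj0')]

theorem continuous_of_mem_trigPoly {n : ℕ} {T : ℝ → ℂ} (hT : T ∈ trigPoly n) : Continuous T := by
  obtain ⟨b, hb⟩ := hT
  rw [funext hb]
  fun_prop

theorem periodic_of_mem_trigPoly {n : ℕ} {T : ℝ → ℂ} (hT : T ∈ trigPoly n) :
    Function.Periodic T (2 * π) := fun x => by
  obtain ⟨b, hb⟩ := hT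
  rw [hb, hb]
  refine Finset.sum_congr rfl fun j _ => ?_
  congr 1
  exact periodic_exp_int j x

/-! ## Best approximation -/

theorem bestApprox_le {n : ℕ} {T : ℝ → ℂ} (hT : T ∈ trigPoly n) (f : ℝ → ℝ) :
    bestApprox p ω n f ≤ wNorm p ω (fun x => (f x : ℂ) - T x) :=
  iInf₂_le T hT

theorem bestApprox_le_of_real (hp1 : ∀ x, 1 ≤ p x) {n : ℕ} {g : ℝ → ℝ}
    (hg : (fun x => (g x : ℂ)) ∈ trigPoly n) (f : ℝ → ℝ) :
    bestApprox p ω n f ≤ wNorm p ω (fun x => f x - g x) := by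
  refine (bestApprox_le hg f).trans (wNorm_mono hp1 fun x => ?_)
  rw [← Complex.ofReal_sub, enorm_le_iff_norm_le, Complex.norm_real]

/-- Convexity of the modular, playing the role of the triangle inequality. -/
theorem periodModular_half_add_half_le (hp : IsLogHolderExponent p) (hω : IsPeriodicWeight ω)
    {g g' : ℝ → ℝ≥0∞} (hg : AEMeasurable g volume) (h : periodModular p ω g ≤ 1)
    (h' : periodModular p ω g' ≤ 1) :
    periodModular p ω (fun x => 1 / 2 * g x + 1 / 2 * g' x) ≤ 1 := by
  have h2 : (1 / 2 : ℝ≥0∞) ≠ ∞ := by simp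
  calc _ ≤ ∫⁻ x in Icc (-π) π, (1 / 2 * (g x ^ p x * ω x) + 1 / 2 * (g' x ^ p x * ω x)) := by
        refine lintegral_mono fun x => ?_
        simp only
        rw [← mul_assoc, ← mul_assoc, ← add_mul]
        gcongr
        exact ENNReal.rpow_arith_mean_le_arith_mean2_rpow _ _ _ _
          (by rw [one_div, ENNReal.inv_two_add_inv_two]) (hp.one_le x)
    _ = 1 / 2 * periodModular p ω g + 1 / 2 * periodModular p ω g' := by
        rw [lintegral_add_left', lintegral_const_mul' _ _ h2, lintegral_const_mul' _ _ h2]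
        · rfl
        · exact (((hg.pow hp.aemeasurable).mul hω.aemeasurable).const_mul _).restrict
    _ ≤ 1 / 2 * 1 + 1 / 2 * 1 := by gcongr
    _ = 1 := by rw [mul_one, one_div, ENNReal.inv_two_add_inv_two]

/-- Removing the mean value of an approximating polynomial costs only a constant. -/
theorem exists_wNorm_sub_re_add_le (hp : IsLogHolderExponent p) (hω : IsMuckenhoupt p ω) :
    ∃ C : ℝ≥0, 0 < C ∧ ∀ (G : ℝ → ℝ) (T : ℝ → ℂ) (c : ℝ), Measurable G →
      Function.Periodic G (2 * π) → Continuous T → Function.Periodic T (2 * π) →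
      IntervalIntegrable G volume (-π) π → ∫ t in (-π)..π, (G t - ((T t).re - c)) = 0 →
      wNorm p ω (fun x => G x - ((T x).re - c)) ≤ C * wNorm p ω (fun x => (G x : ℂ) - T x) := by
  have hpi := Real.pi_pos
  obtain ⟨K, hK1, hK⟩ := exists_periodModular_ballAverage_le hp hω
  have hK0 : 0 < K := one_pos.trans_le hK1
  refine ⟨2 * K, by positivity, fun G T c hG hGper hT hTper hint h0 => ?_⟩
  refine wNorm_le_mul hp.one_le (by positivity) fun a ha hm => ?_
  set q : ℝ → ℝ≥0∞ := fun x => ‖(G x : ℂ) - T x‖ₑ with hq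
  have hqm : Measurable q := ((Complex.measurable_ofReal.comp hG).sub hT.measurable).enorm
  have hqper : Function.Periodic q (2 * π) := fun x => by simp only [hq, hGper x, hTper x]
  have hre : ∀ x, ‖G x - (T x).re‖ₑ ≤ q x := fun x => by
    have := Complex.abs_re_le_norm ((G x : ℂ) - T x)
    rw [Complex.sub_re, Complex.ofReal_re] at this
    simp only [hq, enorm_le_iff_norm_le]
    exact this
  have hTint : IntervalIntegrable (fun t => (T t).re) volume (-π) π :=
    (Complex.continuous_re.comp hT).intervalIntegrable _ _
  -- Since $G-(\operatorname{Re}T-c)$ has mean zero, $-c$ is the mean of $G-\operatorname{Re}T$. So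
  -- $|c|$ is at most the average of $|G-T|$ over a full period, a ball of radius $\pi$ about any
  -- $x$.
  have hc : ∀ x, ‖c‖ₑ ≤ ballAverage π q x := by
    intro x
    have h1 : 2 * π * c = -∫ t in (-π)..π, (G t - (T t).re) := by
      have h2 : ∫ t in (-π)..π, (G t - ((T t).re - c)) =
          (∫ t in (-π)..π, (G t - (T t).re)) + ∫ _ in (-π)..π, c := by
        rw [← intervalIntegral.integral_add (hint.sub hTint) intervalIntegrable_const]
        congr 1; ext t; ring
      rw [h0, intervalIntegral.integral_const, smul_eq_mul] at h2
      linarith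
    rw [ballAverage, ENNReal.le_div_iff_mul_le (Or.inl (by simpa using hpi))
      (Or.inl ENNReal.ofReal_ne_top), mul_comm, ← Real.enorm_eq_ofReal (by positivity),
      ← enorm_mul, h1, enorm_neg, intervalIntegral.integral_of_le (by linarith),
      setLIntegral_congr Ioo_ae_eq_Ioc, show x + π = x - π + 2 * π by ring,
      setLIntegral_Ioc_eq_period hqper, setLIntegral_congr Ioc_ae_eq_Icc.symm]
    exact (enorm_integral_le_lintegral_enorm _).trans (lintegral_mono fun t => hre t)
  have hm' := hK (fun x => q x / a) (hqm.div_const _).aemeasurable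
    (fun x => by simp only [hqper x]) hm π hpi le_rfl
  refine (periodModular_mono hp.one_le fun x => ?_).trans
    (periodModular_half_add_half_le hp hω.weight (hqm.div_const _).aemeasurable hm hm')
  have hK0' : (K : ℝ≥0∞) ≠ 0 := by exact_mod_cast hK0.ne'
  rw [ballAverage_div _ _ ha]
  have h1 : ‖G x - ((T x).re - c)‖ₑ ≤ K * q x + ballAverage π q x := by
    rw [show G x - ((T x).re - c) = (G x - (T x).re) + c by ring]
    refine (enorm_add_le _ _).trans (add_le_add ((hre x).trans ?_) (hc x))
    exact le_mul_of_one_le_left' (by exact_mod_cast hK1)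
  refine (ENNReal.div_le_div_right h1 _).trans (le_of_eq ?_)
  have hinv : ((2 * K * a : ℝ≥0) : ℝ≥0∞)⁻¹ = 2⁻¹ * (K : ℝ≥0∞)⁻¹ * (a : ℝ≥0∞)⁻¹ := by
    rw [ENNReal.coe_mul, ENNReal.coe_mul, ENNReal.mul_inv (Or.inr ENNReal.coe_ne_top)
      (Or.inr (by exact_mod_cast ha.ne')), ENNReal.mul_inv (Or.inr ENNReal.coe_ne_top)
      (Or.inr hK0')]
    rfl
  rw [div_eq_mul_inv, hinv, one_div, div_eq_mul_inv, div_eq_mul_inv, div_eq_mul_inv]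
  calc _ = 2⁻¹ * (q x * (a : ℝ≥0∞)⁻¹) * (K * (K : ℝ≥0∞)⁻¹) +
        2⁻¹ * (ballAverage π q x * (a : ℝ≥0∞)⁻¹ * (K : ℝ≥0∞)⁻¹) := by ring
    _ = _ := by rw [ENNReal.mul_inv_cancel hK0' ENNReal.coe_ne_top, mul_one]

/-- For each $T$, subtract from $F$ the primitive $S$ of $\operatorname{Re}T-c$ and apply the direct
estimate to $F-S$. The kernel order is free here; $k=s+2$ meets the moment condition for every $s$.
-/
theorem exists_bestApprox_mul_le (hp : IsLogHolderExponent p) (hω : IsMuckenhoupt p ω) (s : ℕ) :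
    ∃ C : ℝ≥0, 0 < C ∧ ∀ n : ℕ, 1 ≤ n → ∀ F G : ℝ → ℝ, HasPeriodicDeriv s F G →
      bestApprox p ω n F * (n : ℝ≥0∞) ^ (s + 1) ≤ C * bestApprox p ω n G := by
  obtain ⟨A, hA0, hA⟩ := exists_wNorm_sub_jacksonStechkin_le hp hω
    (show s + 3 ≤ 2 * (s + 2) by omega)
  obtain ⟨B, hB0, hB⟩ := exists_wNorm_sub_re_add_le hp hω
  have hC0 : ((A * B : ℝ≥0) : ℝ≥0∞) ≠ 0 := by exact_mod_cast (mul_pos hA0 hB0).ne'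
  refine ⟨A * B, mul_pos hA0 hB0, fun n hn F G h => ?_⟩
  rw [← ENNReal.div_le_iff' hC0 ENNReal.coe_ne_top]
  refine le_iInf₂ fun T hT => ?_
  rw [ENNReal.div_le_iff' hC0 ENNReal.coe_ne_top]
  obtain ⟨a, c, hac⟩ := exists_reTrigSum_eq hT s
  have hg := h.sub (hasPeriodicDeriv_reTrigSum n a s)
  have hn0 : ((n : ℝ≥0∞) ^ (s + 1)) ≠ 0 := by
    have : (n : ℝ≥0∞) ≠ 0 := by exact_mod_cast (by omega : n ≠ 0)
    exact pow_ne_zero _ this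
  have hn1 : ((n : ℝ≥0∞) ^ (s + 1)) ≠ ∞ := ENNReal.pow_ne_top (ENNReal.natCast_ne_top n)
  have h0 := hg.integral_period
  simp only [hac] at h0
  have h1 := hA n hn _ _ hg
  simp only [hac] at h1
  have h2 := hB G T c h.measurable_deriv h.periodic_deriv (continuous_of_mem_trigPoly hT)
    (periodic_of_mem_trigPoly hT) (h.intervalIntegrable _ _) h0
  -- The competitor is $S+D(F-S)$, whose error is exactly that of the operator on $F-S$.
  have h3 := add_mem_trigPoly (reTrigSum_mem_trigPoly n a)
    (jacksonStechkin_mem_trigPoly hg.contDiff.continuous hg.periodic (s + 2) (s + 1) n)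
  simp only [← Complex.ofReal_add] at h3
  have h4 := bestApprox_le_of_real (ω := ω) hp.one_le h3 F
  simp only [← sub_sub] at h4
  calc bestApprox p ω n F * (n : ℝ≥0∞) ^ (s + 1)
      ≤ A / (n : ℝ≥0∞) ^ (s + 1) * (B * wNorm p ω (fun x => (G x : ℂ) - T x)) *
          (n : ℝ≥0∞) ^ (s + 1) := by
        gcongr
        exact h4.trans (h1.trans (by gcongr))
    _ = (A / (n : ℝ≥0∞) ^ (s + 1) * (n : ℝ≥0∞) ^ (s + 1)) *
          (B * wNorm p ω (fun x => (G x : ℂ) - T x)) := by ring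
    _ = _ := by rw [ENNReal.div_mul_cancel hn0 hn1, ENNReal.coe_mul, mul_assoc]

/-! ### The theorem: order zero and positive order -/

theorem jacksonStechkin_zero (k n : ℕ) (f : ℝ → ℝ) (x : ℝ) : jacksonStechkin k 0 n f x = 0 := by
  simp [jacksonStechkin]

end

theorem theorem11 (p : ℝ → ℝ) (hp : IsLogHolderExponent p)
    (ω : ℝ → ℝ≥0∞) (hω : IsMuckenhoupt p ω) (r : ℕ) :
    (∀ k : ℕ, r ≤ 2 * (k : ℤ) - 2 →
      ∃ C : ℝ≥0, 0 < C ∧ ∀ (α n : ℕ) (f : ℝ → ℝ), 1 ≤ n → MemSobolev p ω (α + r) f →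
        bestApprox p ω n (iteratedDeriv α f) ≤
            wNorm p ω (fun x => iteratedDeriv α f x -
              jacksonStechkin k r n (iteratedDeriv α f) x) ∧
          wNorm p ω (fun x => iteratedDeriv α f x -
              jacksonStechkin k r n (iteratedDeriv α f) x) ≤
            C / (n : ℝ≥0∞) ^ r * wNorm p ω (iteratedDeriv (α + r) f)) ∧
    (∃ C : ℝ≥0, 0 < C ∧ ∀ (α n : ℕ) (f : ℝ → ℝ), 1 ≤ n → MemSobolev p ω (α + r) f →
      bestApprox p ω n (iteratedDeriv α f) * (n : ℝ≥0∞) ^ r ≤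
        C * bestApprox p ω n (iteratedDeriv (α + r) f)) := by
  -- For $r=0$ the operator is identically zero, so $C=1$ works and no continuity of $f$ is needed.
  -- For $r=s+1$ the derivative of order $\alpha$ is continuous.
  rcases r with _ | s
  · refine ⟨fun k _ => ⟨1, one_pos, fun α n f _ _ => ⟨?_, ?_⟩⟩, 1, one_pos, fun α n f _ _ => ?_⟩
    · refine bestApprox_le_of_real hp.one_le ?_ _
      simp only [jacksonStechkin_zero, Complex.ofReal_zero]
      exact zero_mem_trigPoly n
    · simp [jacksonStechkin_zero]
    · simp
  · refine ⟨fun k hk => ?_, ?_⟩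
    · obtain ⟨C, hC0, hC⟩ := exists_wNorm_sub_jacksonStechkin_le hp hω
        (show s + 3 ≤ 2 * k by omega)
      refine ⟨C, hC0, fun α n f hn hf => ?_⟩
      have h := hf.hasPeriodicDeriv
      exact ⟨bestApprox_le_of_real hp.one_le (jacksonStechkin_mem_trigPoly
        h.contDiff.continuous h.periodic k (s + 1) n) _, hC n hn _ _ h⟩
    · obtain ⟨C, hC0, hC⟩ := exists_bestApprox_mul_le hp hω s
      exact ⟨C, hC0, fun α n f hn hf => hC n hn _ _ hf.hasPeriodicDeriv⟩
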